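/- Let $\mathbb D$ be the open unit disk. For functions $g,h$ on $\mathbb D$ write $g\prec h$ if $g=h\circ w$ on $\mathbb D$ for some analytic $w:\mathbb D\to\mathbb D$ with $w(0)=0$. Let $\mathcal A$ be the class of analytic functions $f(z)=z+\sum_{m\ge2}a_mz^m$ on $\mathbb D$. A convex function is an injective analytic function on $\mathbb D$ whose image is convex; a Carathéodory function is an analytic $q$ on $\mathbb D$ with $q(0)=1$ and $\operatorname{Re}q>0$. The logarithmic coefficients $\gamma_m$ of $f$ are defined by $\log\frac{f(z)}{z}=2\sum_{m\ge1}\gamma_mz^m$ on $\mathbb D$. **Theorem.** Let $\phi(z)=1+B_1z+B_2z^2+\cdots$ be a convex function with $\operatorname{Re}\phi>0$ on $\mathbb D$ and $B_1\ne0$. Put $\psi(z)=\frac1z\int_0^z\phi(t)\,dt$ (with $\psi(0)=1$), and let $\sqrt\psi$ be the principal square root. 1. $\psi$ is a convex function and a Carathéodory function, and $\sqrt\psi$ is an injective Carathéodory function. 2. If $f\in\mathcal A$ satisfies $$\frac{zf'(z)}{f(z)}\left(\frac{zf'(z)}{f(z)}+2z\left(\frac{zf'(z)}{f(z)}\right)'\right)\prec\phi(z),$$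 then $\frac{zf'(z)}{f(z)}\prec\sqrt{\psi(z)}$, the logarithmic coefficients of $f$ exist, and $$2\sum_{m=1}^\infty|\gamma_m|r^m\le1\qquad\text{for }0\le r\le 1-\exp\left(-\frac4{|B_1|}\right).$$ 3. There is $f_0\in\mathcal A$ with $\frac{zf_0'(z)}{f_0(z)}=\sqrt{\psi(z)}$ on $\mathbb D$, and it satisfies the subordination in 2. If such an $f_0$ is extremal in the sense that its logarithmic coefficients satisfy $|\gamma_m|=\frac{|B_1|}{8m}$ for every $m\ge1$, then the radius is sharp: $2\sum_{m\ge1}|\gamma_m|r^m>1$ whenever $1-\exp(-4/|B_1|)<r<1$. -/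

import Mathlib

open Complex Set

/-- The open unit disk. -/
def unitDisk : Set ℂ := Metric.ball 0 1

/-- `w` is a Schwarz function: an analytic self-map of the unit disk fixing the origin. -/
def IsSchwarz (w : ℂ → ℂ) : Prop :=
  DifferentiableOn ℂ w unitDisk ∧ w 0 = 0 ∧ ∀ z ∈ unitDisk, w z ∈ unitDisk

/-- Subordination `g ≺ h` on the unit disk: `g = h ∘ w` for a Schwarz function `w`. -/
def Subordinate (g h : ℂ → ℂ) : Prop :=
  ∃ w : ℂ → ℂ, IsSchwarz w ∧ ∀ z ∈ unitDisk, g z = h (w z)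

/-- `φ` is a convex (univalent) function: analytic and injective on the unit disk, with convex
image. -/
def IsConvexFunction (φ : ℂ → ℂ) : Prop :=
  DifferentiableOn ℂ φ unitDisk ∧ InjOn φ unitDisk ∧ Convex ℝ (φ '' unitDisk)

/-- `q` is a (normalized) Carathéodory function. -/
def IsCaratheodory (q : ℂ → ℂ) : Prop :=
  DifferentiableOn ℂ q unitDisk ∧ q 0 = 1 ∧ ∀ z ∈ unitDisk, 0 < (q z).re

/-- The class `𝒜` of analytic functions `f(z) = z + a₂ z² + ⋯` on the unit disk. -/
def ClassA (f : ℂ → ℂ) : Prop :=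
  DifferentiableOn ℂ f unitDisk ∧ f 0 = 0 ∧ deriv f 0 = 1

/-- The function `z f'(z) / f(z)`, with its removable singularity at the origin filled in
(for `f ∈ 𝒜` the limit there is `1`). -/
noncomputable def starQuot (f : ℂ → ℂ) (z : ℂ) : ℂ :=
  if z = 0 then 1 else z * deriv f z / f z

/-- The expression `p (p + 2 z p')` for `p(z) = z f'(z) / f(z)`. -/
noncomputable def diffExpr (f : ℂ → ℂ) (z : ℂ) : ℂ :=
  starQuot f z * (starQuot f z + 2 * z * deriv (starQuot f) z)

/-- The integral mean `(1/z) ∫₀ᶻ φ(ζ) dζ`, where the integral is taken along the segment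
`ζ = t z`, `0 ≤ t ≤ 1`; the factor `z` of `dζ = z dt` cancels, and the value at `0` is `φ 0`. -/
noncomputable def integralMean (φ : ℂ → ℂ) (z : ℂ) : ℂ :=
  ∫ t in (0 : ℝ)..1, φ ((t : ℂ) * z)

/-- The principal square root of the integral mean of `φ`. -/
noncomputable def sqrtMean (φ : ℂ → ℂ) (z : ℂ) : ℂ :=
  integralMean φ z ^ (1 / 2 : ℂ)

/-- `γ` (with `γ m` relevant for `m ≥ 1`) is the sequence of logarithmic coefficients of `f`:
`log (f(z)/z) = 2 ∑_{m ≥ 1} γ m z^m` on the unit disk. The branch `L` of the logarithm is the sum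
of this power series, hence analytic with `L 0 = 0`. -/
def IsLogCoeffs (f : ℂ → ℂ) (γ : ℕ → ℂ) : Prop :=
  ∃ L : ℂ → ℂ, (∀ z ∈ unitDisk, f z = z * exp (L z)) ∧
    ∀ z ∈ unitDisk, HasSum (fun m : ℕ => 2 * γ (m + 1) * z ^ (m + 1)) (L z)

/-!
Put `p = z f' / f` and `u = p ^ 2`. The hypothesis on `f` says that `u + z u' ≺ φ`, while
`ψ + z ψ' = φ`. For a convex univalent function `φ` the quotient `(φ ζ - φ ω) / (ζ φ' ζ)` has
nonnegative real part whenever `|ω| ≤ |ζ|`. Averaging over `ω = t ζ` shows `re (ψ' / φ') ≥ 0`, so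
`ψ` is close to convex, hence univalent. The quotient `q = (ψ - u) / (z ψ')` satisfies
`q + (ψ' / φ') z q' = (φ - (u + z u')) / (z φ')`, whose right side has nonnegative real part, and
the minimum principle applied to `re q` gives `re q ≥ 0`. Applied to rotations and contractions of
`ψ` and of `u`, this places supporting lines on the curves `ψ (|z| = r)`, which yields both the
convexity of `ψ` and `u ≺ ψ`; taking square roots, `p ≺ √ψ`.

For the Bohr radius, write `p = 1 + ∑ a_n z ^ n`, so that `2 γ_n = a_n / n`, and let `b = |B₁| ≤ 2`.
The coefficients of `u + z u'` are at most `b` by Rogosinski's theorem, so those of `p ^ 2` are at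
most `b / (n + 1)`. By Parseval's identity and the Cauchy–Schwarz inequality on circles,
`(1 + ∑ |a_n| ^ 2) ^ 2 ≤ 1 + (π ^ 2 / 6 - 1) b ^ 2`. Another use of the Cauchy–Schwarz inequality
bounds `(∑ |a_n| r ^ n / n) ^ 2` by `∑ |a_n| ^ 2 * ∑ (r ^ n / n) ^ 2`, which is at most `1` for
`r ≤ 1 - exp (-4 / b)`. If `|γ_n| = b / (8 n)`, the series sums to `-(b / 8) log (1 - r)`, and the
radius is exactly where its double reaches `1`.
-/

open Filter Topology Metric

theorem mem_unitDisk {z : ℂ} : z ∈ unitDisk ↔ ‖z‖ < 1 := mem_ball_zero_iff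

theorem isOpen_unitDisk : IsOpen unitDisk := isOpen_ball

theorem zero_mem_unitDisk : (0 : ℂ) ∈ unitDisk := mem_ball_self one_pos

theorem mem_unitDisk_of_norm_le {z w : ℂ} (h : ‖z‖ ≤ ‖w‖) (hw : w ∈ unitDisk) : z ∈ unitDisk :=
  mem_unitDisk.2 (h.trans_lt (mem_unitDisk.1 hw))

theorem norm_mul_le_of_norm_le_one {x : ℂ} (hx : ‖x‖ ≤ 1) (z : ℂ) : ‖x * z‖ ≤ ‖z‖ := by
  rw [norm_mul]
  exact mul_le_of_le_one_left (norm_nonneg z) hx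

theorem mul_mem_unitDisk {x z : ℂ} (hx : ‖x‖ ≤ 1) (hz : z ∈ unitDisk) : x * z ∈ unitDisk :=
  mem_unitDisk_of_norm_le (norm_mul_le_of_norm_le_one hx z) hz

theorem differentiableAt_of_mem_unitDisk {f : ℂ → ℂ} (hf : DifferentiableOn ℂ f unitDisk) {z : ℂ}
    (hz : z ∈ unitDisk) : DifferentiableAt ℂ f z :=
  hf.differentiableAt (isOpen_unitDisk.mem_nhds hz)

theorem hasDerivAt_comp_const_mul {f : ℂ → ℂ} (hf : DifferentiableOn ℂ f unitDisk) {x z : ℂ}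
    (hx : ‖x‖ ≤ 1) (hz : z ∈ unitDisk) :
    HasDerivAt (fun y ↦ f (x * y)) (x * deriv f (x * z)) z := by
  have hxz := (differentiableAt_of_mem_unitDisk hf (mul_mem_unitDisk hx hz)).hasDerivAt
  rw [mul_comm x (deriv f (x * z))]
  exact hxz.comp z (by simpa using (hasDerivAt_id z).const_mul x)

theorem differentiableOn_comp_const_mul {f : ℂ → ℂ} (hf : DifferentiableOn ℂ f unitDisk) {x : ℂ}
    (hx : ‖x‖ ≤ 1) : DifferentiableOn ℂ (fun y ↦ f (x * y)) unitDisk :=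
  fun _ hz ↦ (hasDerivAt_comp_const_mul hf hx hz).differentiableAt.differentiableWithinAt

theorem exists_analyticAt_pow_eq {g : ℂ → ℂ} {z₀ : ℂ} (hg : AnalyticAt ℂ g z₀) (hg₀ : g z₀ ≠ 0)
    {n : ℕ} (hn : n ≠ 0) : ∃ h : ℂ → ℂ, AnalyticAt ℂ h z₀ ∧ ∀ z, h z ^ n = g z := by
  obtain ⟨c, hc⟩ := IsAlgClosed.exists_pow_nat_eq (g z₀) (Nat.pos_of_ne_zero hn)
  refine ⟨fun z ↦ c * (g z / g z₀) ^ (n : ℂ)⁻¹, analyticAt_const.mul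
    ((hg.div analyticAt_const hg₀).cpow analyticAt_const (by simp [hg₀])), fun z ↦ ?_⟩
  rw [mul_pow, hc, cpow_nat_inv_pow _ hn, mul_div_cancel₀ _ hg₀]

theorem exists_eventuallyEq_add_pow {f : ℂ → ℂ} {z₀ : ℂ} (hf : AnalyticAt ℂ f z₀)
    (hconst : ¬∀ᶠ z in 𝓝 z₀, f z = f z₀) :
    ∃ (n : ℕ) (k : ℂ → ℂ) (c : ℂ), n ≠ 0 ∧ c ≠ 0 ∧ k z₀ = 0 ∧ HasStrictDerivAt k c z₀ ∧
      ∀ᶠ z in 𝓝 z₀, f z = f z₀ + k z ^ n := by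
  obtain ⟨n, g, hg, hg₀, hfg⟩ :=
    (hf.sub analyticAt_const).exists_eventuallyEq_pow_smul_nonzero_iff.2
      (by simpa only [Pi.sub_apply, sub_eq_zero] using hconst)
  have hn : n ≠ 0 := by
    rintro rfl
    exact hg₀ (by simpa using hfg.self_of_nhds.symm)
  obtain ⟨h, hh, hpow⟩ := exists_analyticAt_pow_eq hg hg₀ hn
  have hk : HasStrictDerivAt (fun z ↦ (z - z₀) * h z) (h z₀) z₀ := by
    have hid : HasStrictDerivAt (fun z ↦ z - z₀) 1 z₀ := (hasStrictDerivAt_id z₀).sub_const z₀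
    simpa using hid.fun_mul hh.hasStrictDerivAt
  refine ⟨n, fun z ↦ (z - z₀) * h z, h z₀, hn, ?_, by simp, hk, ?_⟩
  · rintro h0
    exact hg₀ (by rw [← hpow, h0, zero_pow hn])
  · filter_upwards [hfg] with z hz
    rw [mul_pow, hpow, ← smul_eq_mul, ← hz, Pi.sub_apply, add_sub_cancel]

theorem eq_one_of_injOn_pow {s : Set ℂ} (hs : s ∈ 𝓝 (0 : ℂ)) {n : ℕ} (hn : n ≠ 0)
    (hinj : InjOn (fun z : ℂ ↦ z ^ n) s) : n = 1 := by
  obtain ⟨ε, hε, hball⟩ := Metric.mem_nhds_iff.1 hs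
  obtain ⟨ω, hω⟩ : ∃ ω : ℂ, IsPrimitiveRoot ω n := ⟨_, isPrimitiveRoot_exp n hn⟩
  have hx : ‖((ε / 2 : ℝ) : ℂ)‖ < ε := by
    rw [norm_real, Real.norm_of_nonneg (half_pos hε).le]
    exact half_lt_self hε
  have hωx : ‖ω * ((ε / 2 : ℝ) : ℂ)‖ < ε := by rwa [norm_mul, hω.norm'_eq_one hn, one_mul]
  have heq : ω * ((ε / 2 : ℝ) : ℂ) = ((ε / 2 : ℝ) : ℂ) :=
    hinj (hball (mem_ball_zero_iff.2 hωx)) (hball (mem_ball_zero_iff.2 hx))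
      (by simp only [mul_pow, hω.pow_eq_one, one_mul])
  have hω1 : ω = 1 :=
    mul_right_cancel₀ (ofReal_ne_zero.2 (half_pos hε).ne') (heq.trans (one_mul _).symm)
  exact hω.unique (hω1 ▸ IsPrimitiveRoot.one)

section Univalent

variable {f g : ℂ → ℂ} {U V : Set ℂ} {z : ℂ}

theorem deriv_ne_zero_of_injOn (hU : IsOpen U) (hf : DifferentiableOn ℂ f U) (hinj : InjOn f U)
    (hz : z ∈ U) : deriv f z ≠ 0 := by
  have hUz : U ∈ 𝓝 z := hU.mem_nhds hz
  have hconst : ¬∀ᶠ y in 𝓝 z, f y = f z := fun h ↦ by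
    have hfalse : ∀ᶠ _ in 𝓝[≠] z, False := by
      filter_upwards [nhdsWithin_le_nhds h, nhdsWithin_le_nhds hUz, self_mem_nhdsWithin]
        with y hy hyU hyz using hyz (hinj hyU hz hy)
    simpa using hfalse.exists
  obtain ⟨n, k, c, hn, hc, hk₀, hk, hfk⟩ := exists_eventuallyEq_add_pow (hf.analyticAt hUz) hconst
  have hgood : ∀ᶠ y in 𝓝 z, y ∈ U ∧ f y = f z + k y ^ n := hfk.and hUz |>.mono fun _ h ↦ h.symm
  have himage : k '' {y | y ∈ U ∧ f y = f z + k y ^ n} ∈ 𝓝 (0 : ℂ) := by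
    rw [← hk₀, ← hk.map_nhds_eq hc]
    exact image_mem_map hgood
  have hn1 : n = 1 := by
    refine eq_one_of_injOn_pow himage hn ?_
    rintro _ ⟨x, ⟨hxU, hx⟩, rfl⟩ _ ⟨y, ⟨hyU, hy⟩, rfl⟩ (hxy : k x ^ n = k y ^ n)
    rw [hinj hxU hyU (by rw [hx, hy, hxy])]
  subst hn1
  rw [EventuallyEq.deriv_eq hfk, deriv_const_add]
  simpa only [pow_one, hk.hasDerivAt.deriv] using hc

theorem image_mem_nhds_of_injOn (hU : IsOpen U) (hf : DifferentiableOn ℂ f U) (hinj : InjOn f U)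
    (hz : z ∈ U) (hV : V ∈ 𝓝 z) : f '' V ∈ 𝓝 (f z) := by
  rw [← (hf.analyticAt (hU.mem_nhds hz)).hasStrictDerivAt.map_nhds_eq
    (deriv_ne_zero_of_injOn hU hf hinj hz)]
  exact image_mem_map hV

theorem hasDerivAt_invFunOn (hU : IsOpen U) (hf : DifferentiableOn ℂ f U) (hinj : InjOn f U)
    (hz : z ∈ U) : HasDerivAt (Function.invFunOn f U) (deriv f z)⁻¹ (f z) := by
  have hstrict := (hf.analyticAt (hU.mem_nhds hz)).hasStrictDerivAt
  refine (hstrict.to_local_left_inverse (deriv_ne_zero_of_injOn hU hf hinj hz) ?_).hasDerivAt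
  filter_upwards [hU.mem_nhds hz] with x hx using hinj.leftInvOn_invFunOn hx

theorem differentiableOn_invFunOn_comp (hU : IsOpen U) (hf : DifferentiableOn ℂ f U)
    (hinj : InjOn f U) (hg : DifferentiableOn ℂ g V) (hgV : MapsTo g V (f '' U)) :
    DifferentiableOn ℂ (fun z ↦ Function.invFunOn f U (g z)) V := by
  intro z hz
  have hinv := hasDerivAt_invFunOn hU hf hinj (Function.invFunOn_mem (hgV hz))
  rw [Function.invFunOn_eq (hgV hz)] at hinv
  exact hinv.differentiableAt.comp_differentiableWithinAt z (hg z hz)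

end Univalent

namespace IsSchwarz

variable {w : ℂ → ℂ}

theorem norm_le (hw : IsSchwarz w) {z : ℂ} (hz : z ∈ unitDisk) : ‖w z‖ ≤ ‖z‖ :=
  norm_le_norm_of_mapsTo_ball hw.1 (fun _ h ↦ ball_subset_closedBall (hw.2.2 _ h)) hw.2.1
    (mem_unitDisk.1 hz)

theorem norm_deriv_le_one (hw : IsSchwarz w) : ‖deriv w 0‖ ≤ 1 :=
  norm_deriv_le_one_of_mapsTo_ball hw.1
    (fun _ h ↦ by rw [hw.2.1]; exact ball_subset_closedBall (hw.2.2 _ h)) one_pos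

theorem const_mul {x : ℂ} (hx : ‖x‖ ≤ 1) : IsSchwarz (fun z ↦ x * z) :=
  ⟨differentiableOn_id.const_mul x, mul_zero x, fun _ hz ↦ mul_mem_unitDisk hx hz⟩

theorem comp {v : ℂ → ℂ} (hv : IsSchwarz v) (hw : IsSchwarz w) : IsSchwarz (fun z ↦ v (w z)) :=
  ⟨hv.1.comp hw.1 hw.2.2, by simp only [hw.2.1, hv.2.1], fun _ hz ↦ hv.2.2 _ (hw.2.2 _ hz)⟩

end IsSchwarz

namespace Subordinate

variable {f g : ℂ → ℂ}

theorem apply_zero (hgf : Subordinate g f) : g 0 = f 0 := by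
  obtain ⟨w, hw, hg⟩ := hgf
  rw [hg 0 zero_mem_unitDisk, hw.2.1]

theorem mem_image (hgf : Subordinate g f) {z : ℂ} (hz : z ∈ unitDisk) : g z ∈ f '' unitDisk := by
  obtain ⟨w, hw, hg⟩ := hgf
  exact ⟨w z, hw.2.2 z hz, (hg z hz).symm⟩

theorem of_injOn (hf : DifferentiableOn ℂ f unitDisk) (hinj : InjOn f unitDisk)
    (hg : DifferentiableOn ℂ g unitDisk) (h0 : g 0 = f 0)
    (hgf : MapsTo g unitDisk (f '' unitDisk)) : Subordinate g f := by
  refine ⟨fun z ↦ Function.invFunOn f unitDisk (g z),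
    ⟨differentiableOn_invFunOn_comp isOpen_unitDisk hf hinj hg hgf, ?_,
      fun z hz ↦ Function.invFunOn_mem (hgf hz)⟩,
    fun z hz ↦ (Function.invFunOn_eq (hgf hz)).symm⟩
  simp only [h0]
  exact hinj.leftInvOn_invFunOn zero_mem_unitDisk

theorem norm_deriv_zero_le (hgf : Subordinate g f) (hf : DifferentiableOn ℂ f unitDisk) :
    ‖deriv g 0‖ ≤ ‖deriv f 0‖ := by
  obtain ⟨w, hw, hg⟩ := hgf
  have hfw : HasDerivAt f (deriv f 0) (w 0) :=
    hw.2.1.symm ▸ (differentiableAt_of_mem_unitDisk hf zero_mem_unitDisk).hasDerivAt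
  have hderiv := hfw.comp 0 (differentiableAt_of_mem_unitDisk hw.1 zero_mem_unitDisk).hasDerivAt
  have heq : g =ᶠ[𝓝 0] f ∘ w := by
    filter_upwards [isOpen_unitDisk.mem_nhds zero_mem_unitDisk] with z hz using hg z hz
  rw [heq.deriv_eq, hderiv.deriv, norm_mul]
  exact mul_le_of_le_one_right (norm_nonneg _) hw.norm_deriv_le_one

end Subordinate

theorem mem_of_forall_frontier_supported {E : Type*} [AddCommGroup E] [TopologicalSpace E]
    [IsTopologicalAddGroup E] [Module ℝ E] [ContinuousSMul ℝ E] {K : Set E} (hK : IsClosed K)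
    {x v : E} (hx : x ∈ interior K)
    (hsupp : ∀ w ∈ frontier K, ∃ f : E →L[ℝ] ℝ, f ≠ 0 ∧ (∀ u ∈ K, f u ≤ f w) ∧ f v ≤ f w) :
    v ∈ K := by
  -- Otherwise the segment from `x` to `v` meets the frontier at some `w ≠ v`, and the functional
  -- supporting `K` at `w` is strictly smaller at the interior point `x`.
  by_contra hv
  obtain ⟨w, hwseg, hwK⟩ : (segment ℝ x v ∩ frontier K).Nonempty := by
    by_contra! hempty
    refine hv (interior_subset ((convex_segment x v).isPreconnected.subset_left_of_subset_union
      isOpen_interior hK.isOpen_compl (disjoint_compl_right.mono_left interior_subset)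
      (fun y hy ↦ ?_) ⟨x, left_mem_segment ℝ x v, hx⟩ (right_mem_segment ℝ x v)))
    by_contra! hyK
    rw [mem_union, not_or, notMem_compl_iff] at hyK
    exact (hempty ▸ ⟨hy, hK.frontier_eq ▸ hyK.symm⟩ : y ∈ (∅ : Set E))
  obtain ⟨f, hf, hfK, hfv⟩ := hsupp w hwK
  have hfx : f x < f w := by
    have hsub : f '' interior K ⊆ interior (Iic (f w)) :=
      interior_maximal (image_subset_iff.2 fun y hy ↦ hfK y (interior_subset hy))
        (f.isOpenMap_of_ne_zero hf _ isOpen_interior)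
    rw [interior_Iic] at hsub
    exact hsub (mem_image_of_mem f hx)
  obtain ⟨s, t, hs, ht, hst, hw⟩ := hwseg
  have hs0 : s = 0 := by
    refine hs.antisymm' (not_lt.1 fun hs ↦ lt_irrefl (f w) ?_)
    calc f w = s * f x + t * f v := by simp [← hw]
      _ < s * f w + t * f w := add_lt_add_of_lt_of_le (mul_lt_mul_of_pos_left hfx hs)
        (mul_le_mul_of_nonneg_left hfv ht)
      _ = f w := by rw [← add_mul, hst, one_mul]
  rw [hs0, zero_add] at hst
  rw [hs0, hst, zero_smul, zero_add, one_smul] at hw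
  exact hv (hw ▸ hK.frontier_subset hwK)

theorem frontier_image_closedBall_subset {f : ℂ → ℂ} {U : Set ℂ} (hU : IsOpen U)
    (hf : DifferentiableOn ℂ f U) (hinj : InjOn f U) {c : ℂ} {r : ℝ} (hr : closedBall c r ⊆ U) :
    frontier (f '' closedBall c r) ⊆ f '' sphere c r := by
  have hclosed : IsClosed (f '' closedBall c r) :=
    ((isCompact_closedBall c r).image_of_continuousOn (hf.continuousOn.mono hr)).isClosed
  rw [hclosed.frontier_eq]
  rintro _ ⟨⟨z, hz, rfl⟩, hz_int⟩
  refine mem_image_of_mem f (hz.antisymm (not_lt.1 fun hlt ↦ hz_int ?_))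
  exact mem_interior_iff_mem_nhds.2
    (image_mem_nhds_of_injOn hU hf hinj (hr hz) (closedBall_mem_nhds_of_mem hlt))

theorem mem_image_closedBall_of_re_sub_div_nonneg {ψ : ℂ → ℂ} (hψ : DifferentiableOn ℂ ψ unitDisk)
    (hinj : InjOn ψ unitDisk) {r : ℝ} (hr₀ : 0 < r) (hr₁ : r < 1) {v : ℂ}
    (hψr : ∀ ζ ξ, ‖ζ‖ = r → ‖ξ‖ ≤ r → 0 ≤ ((ψ ζ - ψ ξ) / (ζ * deriv ψ ζ)).re)
    (hv : ∀ ζ, ‖ζ‖ = r → 0 ≤ ((ψ ζ - v) / (ζ * deriv ψ ζ)).re) : v ∈ ψ '' closedBall 0 r := by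
  have hsub : closedBall 0 r ⊆ unitDisk := closedBall_subset_ball hr₁
  have hzero : ψ 0 ∈ interior (ψ '' closedBall 0 r) := mem_interior_iff_mem_nhds.2
    (image_mem_nhds_of_injOn isOpen_unitDisk hψ hinj zero_mem_unitDisk (closedBall_mem_nhds 0 hr₀))
  refine mem_of_forall_frontier_supported ((isCompact_closedBall 0 r).image_of_continuousOn
    (hψ.continuousOn.mono hsub)).isClosed hzero fun w hw ↦ ?_
  obtain ⟨ζ, hζ, rfl⟩ := frontier_image_closedBall_subset isOpen_unitDisk hψ hinj hsub hw
  rw [mem_sphere_zero_iff_norm] at hζ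
  have hc : ζ * deriv ψ ζ ≠ 0 := mul_ne_zero (norm_pos_iff.1 (hζ ▸ hr₀))
    (deriv_ne_zero_of_injOn isOpen_unitDisk hψ hinj (mem_unitDisk.2 (hζ ▸ hr₁)))
  refine ⟨reCLM.comp (ContinuousLinearMap.mul ℝ ℂ (ζ * deriv ψ ζ)⁻¹), fun h0 ↦ ?_, ?_, ?_⟩
  · have h : ((ζ * deriv ψ ζ)⁻¹ * (ζ * deriv ψ ζ)).re = 0 :=
      DFunLike.congr_fun h0 (ζ * deriv ψ ζ)
    rw [inv_mul_cancel₀ hc] at h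
    exact one_ne_zero h
  · rintro _ ⟨ξ, hξ, rfl⟩
    have h := hψr ζ ξ hζ (mem_closedBall_zero_iff.1 hξ)
    rwa [div_eq_inv_mul, mul_sub, sub_re, sub_nonneg] at h
  · have h := hv ζ hζ
    rwa [div_eq_inv_mul, mul_sub, sub_re, sub_nonneg] at h

theorem hasFDerivAt_re {f : ℂ → ℂ} {f' z : ℂ} (hf : HasDerivAt f f' z) :
    HasFDerivAt (fun z ↦ (f z).re) (reCLM.comp (f' • (1 : ℂ →L[ℝ] ℂ))) z :=
  reCLM.hasFDerivAt.comp z hf.complexToReal_fderiv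

theorem mul_deriv_eq_neg_norm_of_isMinOn_re {q : ℂ → ℂ} {z : ℂ} (hq : DifferentiableAt ℂ q z)
    (hmin : IsMinOn (fun y ↦ (q y).re) (closedBall 0 ‖z‖) z) :
    z * deriv q z = -(‖z * deriv q z‖ : ℂ) := by
  set D := z * deriv q z
  -- Moving from `z` towards `x * z` decreases `re q` unless `z * deriv q z` is a nonpositive real.
  set x : ℂ := -(starRingEnd ℂ D / ‖D‖)
  have hx : ‖x‖ ≤ 1 := by simpa [x] using div_self_le_one ‖D‖
  have hsegment : segment ℝ z (x * z) ⊆ closedBall 0 ‖z‖ :=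
    (convex_closedBall 0 ‖z‖).segment_subset (mem_closedBall_zero_iff.2 le_rfl)
      (mem_closedBall_zero_iff.2 (norm_mul_le_of_norm_le_one hx z))
  have hnonneg := (hmin.localize).hasFDerivWithinAt_nonneg
    (hasFDerivAt_re hq.hasDerivAt).hasFDerivWithinAt
    (sub_mem_posTangentConeAt_of_segment_subset hsegment)
  have hvalue : deriv q z * (x * z - z) = -(‖D‖ : ℂ) - D := by
    have hDx : D * x = -(‖D‖ : ℂ) := by
      rw [mul_neg, ← mul_div_assoc, mul_conj, normSq_eq_norm_sq, sq, ofReal_mul, mul_self_div_self]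
    rw [← hDx]
    ring
  have hre : 0 ≤ -‖D‖ - D.re := by
    have h : 0 ≤ (deriv q z * (x * z - z)).re := hnonneg
    simpa only [hvalue, sub_re, neg_re, ofReal_re] using h
  have hre' : D.re = -‖D‖ := le_antisymm (by linarith) (neg_le_of_abs_le (abs_re_le_norm D))
  have him : D.im = 0 := abs_re_eq_norm.1 (by rw [hre', abs_neg, abs_norm])
  exact Complex.ext (by simpa using hre') (by simpa using him)

theorem re_nonneg_of_re_add_mul_deriv_nonneg {p q : ℂ → ℂ} (hq : DifferentiableOn ℂ q unitDisk)
    (hp : ∀ z ∈ unitDisk, 0 ≤ (p z).re)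
    (hpq : ∀ z ∈ unitDisk, 0 ≤ (q z + p z * (z * deriv q z)).re) {z : ℂ} (hz : z ∈ unitDisk) :
    0 ≤ (q z).re := by
  have hsub : closedBall 0 ‖z‖ ⊆ unitDisk := closedBall_subset_ball (mem_unitDisk.1 hz)
  have hz_mem : z ∈ closedBall 0 ‖z‖ := mem_closedBall_zero_iff.2 le_rfl
  obtain ⟨z₀, hz₀, hmin⟩ := (isCompact_closedBall 0 ‖z‖).exists_isMinOn ⟨z, hz_mem⟩
    (continuous_re.comp_continuousOn (hq.continuousOn.mono hsub))
  have hD := mul_deriv_eq_neg_norm_of_isMinOn_re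
    (differentiableAt_of_mem_unitDisk hq (hsub hz₀))
    (hmin.on_subset (closedBall_subset_closedBall (mem_closedBall_zero_iff.1 hz₀)))
  have hz₀_re : 0 ≤ (q z₀).re := by
    have h := hpq z₀ (hsub hz₀)
    rw [hD, mul_neg, add_re, neg_re, re_mul_ofReal] at h
    linarith [mul_nonneg (hp z₀ (hsub hz₀)) (norm_nonneg (z₀ * deriv q z₀))]
  exact hz₀_re.trans (hmin hz_mem)

namespace IsConvexFunction

variable {φ : ℂ → ℂ}

theorem deriv_ne_zero (hφ : IsConvexFunction φ) {z : ℂ} (hz : z ∈ unitDisk) : deriv φ z ≠ 0 :=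
  deriv_ne_zero_of_injOn isOpen_unitDisk hφ.1 hφ.2.1 hz

theorem segment_subset_image_closedBall (hφ : IsConvexFunction φ) {ζ ω : ℂ} (hζ : ζ ∈ unitDisk)
    (hω : ‖ω‖ ≤ ‖ζ‖) : segment ℝ (φ ζ) (φ ω) ⊆ φ '' closedBall 0 ‖ζ‖ := by
  obtain ⟨x, hx, rfl⟩ : ∃ x : ℂ, ‖x‖ ≤ 1 ∧ x * ζ = ω := by
    rcases eq_or_ne ζ 0 with rfl | hζ0
    · exact ⟨0, by simp, by simpa [eq_comm] using hω⟩
    · exact ⟨ω / ζ, by simpa using div_le_one_of_le₀ hω (norm_nonneg ζ), div_mul_cancel₀ ω hζ0⟩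
  rintro _ ⟨a, b, ha, hb, hab, rfl⟩
  obtain ⟨w, hw, hφw⟩ : Subordinate (fun y ↦ a • φ y + b • φ (x * y)) φ := by
    refine .of_injOn hφ.1 hφ.2.1
      ((hφ.1.const_smul a).add ((differentiableOn_comp_const_mul hφ.1 hx).const_smul b)) ?_ ?_
    · rw [mul_zero, ← add_smul, hab, one_smul]
    · exact fun y hy ↦ hφ.2.2 (mem_image_of_mem φ hy)
        (mem_image_of_mem φ (mul_mem_unitDisk hx hy)) ha hb hab
  exact ⟨w ζ, mem_closedBall_zero_iff.2 (hw.norm_le hζ), (hφw ζ hζ).symm⟩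

theorem re_sub_div_nonneg (hφ : IsConvexFunction φ) {ζ ω : ℂ} (hζ : ζ ∈ unitDisk)
    (hω : ‖ω‖ ≤ ‖ζ‖) : 0 ≤ ((φ ζ - φ ω) / (ζ * deriv φ ζ)).re := by
  set g := Function.invFunOn φ unitDisk
  have hg : LeftInvOn g φ unitDisk := hφ.2.1.leftInvOn_invFunOn
  -- `g` maps the segment into the disk of radius `‖ζ‖`, so `re (conj ζ * g)` is largest at `φ ζ`.
  have hmax : IsMaxOn (fun v ↦ (starRingEnd ℂ ζ * g v).re) (segment ℝ (φ ζ) (φ ω)) (φ ζ) := by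
    intro v hv
    obtain ⟨y, hy, rfl⟩ := hφ.segment_subset_image_closedBall hζ hω hv
    rw [mem_closedBall_zero_iff] at hy
    change (starRingEnd ℂ ζ * g (φ y)).re ≤ (starRingEnd ℂ ζ * g (φ ζ)).re
    rw [hg hζ, hg (mem_unitDisk_of_norm_le hy hζ), conj_mul', ← ofReal_pow, ofReal_re]
    calc (starRingEnd ℂ ζ * y).re ≤ ‖ζ‖ * ‖y‖ := by simpa using re_le_norm (starRingEnd ℂ ζ * y)
      _ ≤ ‖ζ‖ ^ 2 := by rw [sq]; gcongr
  have hderiv : HasDerivAt (fun v ↦ starRingEnd ℂ ζ * g v) (starRingEnd ℂ ζ * (deriv φ ζ)⁻¹)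
      (φ ζ) := (hasDerivAt_invFunOn isOpen_unitDisk hφ.1 hφ.2.1 hζ).const_mul _
  have hnonpos : (starRingEnd ℂ ζ * (deriv φ ζ)⁻¹ * (φ ω - φ ζ)).re ≤ 0 :=
    hmax.localize.hasFDerivWithinAt_nonpos (hasFDerivAt_re hderiv).hasFDerivWithinAt
      (sub_mem_posTangentConeAt_of_segment_subset Subset.rfl)
  have hquot : (φ ζ - φ ω) / (ζ * deriv φ ζ) =
      ((normSq ζ)⁻¹ : ℝ) * -(starRingEnd ℂ ζ * (deriv φ ζ)⁻¹ * (φ ω - φ ζ)) := by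
    rw [div_eq_mul_inv, mul_inv, inv_def]
    ring
  rw [hquot, re_ofReal_mul, neg_re]
  exact mul_nonneg (inv_nonneg.2 (normSq_nonneg ζ)) (neg_nonneg.2 hnonpos)

end IsConvexFunction

theorem Subordinate.refl (f : ℂ → ℂ) : Subordinate f f :=
  ⟨fun z ↦ z, ⟨differentiableOn_id, rfl, fun _ hz ↦ hz⟩, fun _ _ ↦ rfl⟩

theorem Subordinate.comp_const_mul {f g : ℂ → ℂ} (hgf : Subordinate g f) {x : ℂ} (hx : ‖x‖ ≤ 1) :
    Subordinate (fun z ↦ g (x * z)) f := by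
  obtain ⟨w, hw, hg⟩ := hgf
  exact ⟨_, hw.comp (IsSchwarz.const_mul hx), fun z hz ↦ hg _ (mul_mem_unitDisk hx hz)⟩

theorem Subordinate.congr {f g h : ℂ → ℂ} (hgf : Subordinate g f) (hhg : EqOn h g unitDisk) :
    Subordinate h f := by
  obtain ⟨w, hw, hg⟩ := hgf
  exact ⟨w, hw, fun z hz ↦ (hhg hz).trans (hg z hz)⟩

theorem two_mul_deriv_zero_of_add_mul_deriv {u g : ℂ → ℂ} (hu : DifferentiableOn ℂ u unitDisk)
    (hug : ∀ z ∈ unitDisk, u z + z * deriv u z = g z) : 2 * deriv u 0 = deriv g 0 := by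
  have hu₀ := differentiableAt_of_mem_unitDisk hu zero_mem_unitDisk
  have hu'₀ := differentiableAt_of_mem_unitDisk (hu.deriv isOpen_unitDisk) zero_mem_unitDisk
  have hderiv : HasDerivAt (fun z ↦ u z + z * deriv u z)
      (deriv u 0 + (1 * deriv u 0 + 0 * deriv (deriv u) 0)) 0 :=
    hu₀.hasDerivAt.add ((hasDerivAt_id 0).mul hu'₀.hasDerivAt)
  have heq : (fun z ↦ u z + z * deriv u z) =ᶠ[𝓝 0] g := by
    filter_upwards [isOpen_unitDisk.mem_nhds zero_mem_unitDisk] with z hz using hug z hz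
  rw [← heq.deriv_eq, hderiv.deriv]
  ring

section IntegralMean

variable {φ : ℂ → ℂ} {z : ℂ}

theorem norm_ofReal_le_one {t : ℝ} (ht : t ∈ Icc (0 : ℝ) 1) : ‖(t : ℂ)‖ ≤ 1 := by
  rw [norm_real, Real.norm_of_nonneg ht.1]
  exact ht.2

theorem continuousOn_comp_ofReal_mul (hφ : ContinuousOn φ unitDisk) (hz : z ∈ unitDisk) :
    ContinuousOn (fun t : ℝ ↦ φ (t * z)) (Icc 0 1) :=
  hφ.comp (by fun_prop) fun _ ht ↦ mul_mem_unitDisk (norm_ofReal_le_one ht) hz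

theorem integralMean_zero (φ : ℂ → ℂ) : integralMean φ 0 = φ 0 := by simp [integralMean]

theorem mul_integralMean {Φ : ℂ → ℂ} (hφ : ContinuousOn φ unitDisk)
    (hΦ : ∀ z ∈ unitDisk, HasDerivAt Φ (φ z) z) (hz : z ∈ unitDisk) :
    z * integralMean φ z = Φ z - Φ 0 := by
  have h := intervalIntegral.integral_unitInterval_deriv_eq_sub (f := Φ) (f' := φ) (z₀ := 0)
    (z₁ := z) (by simpa using continuousOn_comp_ofReal_mul hφ hz) fun t ht ↦
      hΦ _ (by simpa using mul_mem_unitDisk (norm_ofReal_le_one ht) hz)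
  simpa [integralMean] using h

theorem differentiableOn_integralMean (hφ : DifferentiableOn ℂ φ unitDisk) :
    DifferentiableOn ℂ (integralMean φ) unitDisk := by
  obtain ⟨Φ, hΦ⟩ := hφ.isExactOn_ball
  have hslope : DifferentiableOn ℂ (dslope Φ 0) unitDisk :=
    (differentiableOn_dslope (isOpen_unitDisk.mem_nhds zero_mem_unitDisk)).2
      fun z hz ↦ (hΦ z hz).differentiableAt.differentiableWithinAt
  refine hslope.congr fun z hz ↦ ?_
  rcases eq_or_ne z 0 with rfl | hz0
  · rw [integralMean_zero, dslope_same, (hΦ 0 hz).deriv]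
  · refine mul_left_cancel₀ hz0 ?_
    rw [mul_integralMean hφ.continuousOn hΦ hz]
    simpa using (sub_smul_dslope Φ 0 z).symm

theorem integralMean_add_mul_deriv (hφ : DifferentiableOn ℂ φ unitDisk) (hz : z ∈ unitDisk) :
    integralMean φ z + z * deriv (integralMean φ) z = φ z := by
  obtain ⟨Φ, hΦ⟩ := hφ.isExactOn_ball
  have hprod : HasDerivAt (fun y ↦ y * integralMean φ y)
      (1 * integralMean φ z + z * deriv (integralMean φ) z) z :=
    (hasDerivAt_id z).mul
      (differentiableAt_of_mem_unitDisk (differentiableOn_integralMean hφ) hz).hasDerivAt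
  have hprimitive : HasDerivAt (fun y ↦ y * integralMean φ y) (φ z) z := by
    refine ((hΦ z hz).sub_const (Φ 0)).congr_of_eventuallyEq ?_
    filter_upwards [isOpen_unitDisk.mem_nhds hz] with y hy
      using mul_integralMean hφ.continuousOn hΦ hy
  rw [← hprod.unique hprimitive, one_mul]

theorem two_mul_deriv_integralMean_zero (hφ : DifferentiableOn ℂ φ unitDisk) :
    2 * deriv (integralMean φ) 0 = deriv φ 0 :=
  two_mul_deriv_zero_of_add_mul_deriv (differentiableOn_integralMean hφ)
    fun _ hz ↦ integralMean_add_mul_deriv hφ hz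

theorem re_integralMean_pos (hφ : ContinuousOn φ unitDisk) (hre : ∀ z ∈ unitDisk, 0 < (φ z).re)
    (hz : z ∈ unitDisk) : 0 < (integralMean φ z).re := by
  have hcont : ContinuousOn (fun t : ℝ ↦ φ (t * z)) (uIcc 0 1) := by
    simpa only [uIcc_of_le zero_le_one] using continuousOn_comp_ofReal_mul hφ hz
  have hint : (integralMean φ z).re = ∫ t in (0 : ℝ)..1, (φ (t * z)).re :=
    (reCLM.intervalIntegral_comp_comm hcont.intervalIntegrable).symm
  rw [hint]
  exact intervalIntegral.intervalIntegral_pos_of_pos_on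
    (continuous_re.comp_continuousOn hcont).intervalIntegrable (fun t ht ↦
      hre _ (mul_mem_unitDisk (norm_ofReal_le_one (Ioo_subset_Icc_self ht)) hz)) one_pos

theorem isCaratheodory_integralMean (hφ : DifferentiableOn ℂ φ unitDisk) (hφ₀ : φ 0 = 1)
    (hre : ∀ z ∈ unitDisk, 0 < (φ z).re) : IsCaratheodory (integralMean φ) :=
  ⟨differentiableOn_integralMean hφ, (integralMean_zero φ).trans hφ₀,
    fun _ hz ↦ re_integralMean_pos hφ.continuousOn hre hz⟩

end IntegralMean

theorem re_pos_of_re_nonneg {p : ℂ → ℂ} {U : Set ℂ} (hU : IsOpen U) (hUc : IsPreconnected U)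
    (hp : DifferentiableOn ℂ p U) (hre : ∀ z ∈ U, 0 ≤ (p z).re) {z₀ : ℂ} (hz₀ : z₀ ∈ U)
    (hpos : 0 < (p z₀).re) {z : ℂ} (hz : z ∈ U) : 0 < (p z).re := by
  refine (hre z hz).lt_of_ne' fun hz_re ↦ hpos.ne' ?_
  have hmax : IsMaxOn (norm ∘ fun y ↦ exp (-p y)) U z := by
    intro y hy
    simpa [norm_exp, hz_re] using hre y hy
  have heq := norm_eqOn_of_isPreconnected_of_isMaxOn hUc hU hp.neg.cexp hz hmax hz₀
  simpa [norm_exp, hz_re] using heq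

theorem injOn_of_re_deriv_pos {F F' : ℂ → ℂ} {V : Set ℂ} (hV : Convex ℝ V)
    (hF : ∀ v ∈ V, HasDerivAt F (F' v) v) (hre : ∀ v ∈ V, 0 < (F' v).re) : InjOn F V := by
  intro a ha b hb hab
  by_contra hne
  have hba : b - a ≠ 0 := sub_ne_zero.2 (Ne.symm hne)
  have hmem : ∀ t ∈ Icc (0 : ℝ) 1, a + t * (b - a) ∈ V := fun t ht ↦ by
    simpa using hV.add_smul_sub_mem ha hb ht
  have hderiv : ∀ t ∈ Icc (0 : ℝ) 1, HasDerivAt (fun t : ℝ ↦ (F (a + t * (b - a)) / (b - a)).re)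
      (F' (a + t * (b - a))).re t := fun t ht ↦ by
    have hline : HasDerivAt (fun t : ℝ ↦ a + t * (b - a)) (b - a) t := by
      simpa using ((ofRealCLM.hasDerivAt (x := t)).mul_const (b - a)).const_add a
    have h := ((hF _ (hmem t ht)).comp t hline).div_const (b - a)
    rw [mul_div_cancel_right₀ _ hba] at h
    exact reCLM.hasFDerivAt.comp_hasDerivAt t h
  obtain ⟨t, ht, ht0⟩ := exists_hasDerivAt_eq_zero one_pos
    (fun t ht ↦ (hderiv t ht).continuousAt.continuousWithinAt) (by simp [hab])
    fun t ht ↦ hderiv t (Ioo_subset_Icc_self ht)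
  exact (hre _ (hmem t (Ioo_subset_Icc_self ht))).ne' ht0

theorem deriv_div_deriv_eq {𝕜 : Type*} [NontriviallyNormedField 𝕜] {A B : 𝕜 → 𝕜} {A' B' z : 𝕜}
    (hA : HasDerivAt A A' z) (hB : HasDerivAt B B' z) (hz : B z ≠ 0) (hB' : B' ≠ 0) :
    A' / B' = A z / B z + B z / B' * deriv (fun y ↦ A y / B y) z := by
  rw [(hA.fun_div hB hz).deriv]
  field

namespace IsConvexFunction

variable {φ u : ℂ → ℂ}

theorem injOn_of_re_deriv_div_pos (hφ : IsConvexFunction φ) (hu : DifferentiableOn ℂ u unitDisk)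
    (hre : ∀ z ∈ unitDisk, 0 < (deriv u z / deriv φ z).re) : InjOn u unitDisk := by
  set g := Function.invFunOn φ unitDisk
  have hg : LeftInvOn g φ unitDisk := hφ.2.1.leftInvOn_invFunOn
  have hinj : InjOn (fun v ↦ u (g v)) (φ '' unitDisk) := by
    refine injOn_of_re_deriv_pos (F' := fun v ↦ deriv u (g v) / deriv φ (g v)) hφ.2.2 ?_ ?_
    · rintro _ ⟨z, hz, rfl⟩
      have hu' := (differentiableAt_of_mem_unitDisk hu hz).hasDerivAt
      rw [← hg hz] at hu'
      have h := hu'.comp (φ z) (hasDerivAt_invFunOn isOpen_unitDisk hφ.1 hφ.2.1 hz)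
      simp only [hg hz, div_eq_mul_inv]
      rw [hg hz] at h
      exact h
    · rintro _ ⟨z, hz, rfl⟩
      simpa only [hg hz] using hre z hz
  intro a ha b hb hab
  exact hφ.2.1 ha hb (hinj (mem_image_of_mem φ ha) (mem_image_of_mem φ hb)
    (by simpa only [hg ha, hg hb] using hab))

theorem deriv_integralMean_div_zero (hφ : IsConvexFunction φ) :
    deriv (integralMean φ) 0 / deriv φ 0 = (1 / 2 : ℝ) := by
  rw [div_eq_iff (hφ.deriv_ne_zero zero_mem_unitDisk), ← two_mul_deriv_integralMean_zero hφ.1]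
  push_cast
  ring

theorem re_deriv_integralMean_div_nonneg (hφ : IsConvexFunction φ) {z : ℂ} (hz : z ∈ unitDisk) :
    0 ≤ (deriv (integralMean φ) z / deriv φ z).re := by
  rcases eq_or_ne z 0 with rfl | hz0
  · rw [hφ.deriv_integralMean_div_zero, ofReal_re]
    norm_num
  have hcont : ContinuousOn (fun t : ℝ ↦ φ (t * z)) (uIcc 0 1) := by
    simpa only [uIcc_of_le zero_le_one] using continuousOn_comp_ofReal_mul hφ.1.continuousOn hz
  have hint : deriv (integralMean φ) z / deriv φ z =
      ∫ t in (0 : ℝ)..1, (φ z - φ (t * z)) / (z * deriv φ z) := by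
    rw [intervalIntegral.integral_div, intervalIntegral.integral_sub intervalIntegrable_const
      hcont.intervalIntegrable, intervalIntegral.integral_const, sub_zero, one_smul]
    change _ = (φ z - integralMean φ z) / _
    rw [← integralMean_add_mul_deriv hφ.1 hz, add_sub_cancel_left, mul_div_mul_left _ _ hz0]
  have hcont' : ContinuousOn (fun t : ℝ ↦ (φ z - φ (t * z)) / (z * deriv φ z)) (uIcc 0 1) :=
    (continuousOn_const.sub hcont).div_const _
  have hint_re : (∫ t in (0 : ℝ)..1, (φ z - φ (t * z)) / (z * deriv φ z)).re =
      ∫ t in (0 : ℝ)..1, ((φ z - φ (t * z)) / (z * deriv φ z)).re :=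
    (reCLM.intervalIntegral_comp_comm hcont'.intervalIntegrable).symm
  rw [hint, hint_re]
  exact intervalIntegral.integral_nonneg zero_le_one fun t ht ↦
    hφ.re_sub_div_nonneg hz (norm_mul_le_of_norm_le_one (norm_ofReal_le_one ht) z)

theorem re_deriv_integralMean_div_pos (hφ : IsConvexFunction φ) {z : ℂ} (hz : z ∈ unitDisk) :
    0 < (deriv (integralMean φ) z / deriv φ z).re := by
  refine re_pos_of_re_nonneg isOpen_unitDisk (convex_ball 0 1).isPreconnected
    (((differentiableOn_integralMean hφ.1).deriv isOpen_unitDisk).div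
      (hφ.1.deriv isOpen_unitDisk) fun _ hy ↦ hφ.deriv_ne_zero hy)
    (fun _ hy ↦ hφ.re_deriv_integralMean_div_nonneg hy) zero_mem_unitDisk ?_ hz
  rw [Pi.div_apply, hφ.deriv_integralMean_div_zero, ofReal_re]
  norm_num

theorem injOn_integralMean (hφ : IsConvexFunction φ) : InjOn (integralMean φ) unitDisk :=
  hφ.injOn_of_re_deriv_div_pos (differentiableOn_integralMean hφ.1)
    fun _ hz ↦ hφ.re_deriv_integralMean_div_pos hz

theorem deriv_integralMean_ne_zero (hφ : IsConvexFunction φ) {z : ℂ} (hz : z ∈ unitDisk) :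
    deriv (integralMean φ) z ≠ 0 :=
  deriv_ne_zero_of_injOn isOpen_unitDisk (differentiableOn_integralMean hφ.1)
    hφ.injOn_integralMean hz

variable {z : ℂ}

theorem norm_deriv_zero_le_integralMean (hφ : IsConvexFunction φ)
    (hu : DifferentiableOn ℂ u unitDisk) (hsub : Subordinate (fun z ↦ u z + z * deriv u z) φ) :
    ‖deriv u 0‖ ≤ ‖deriv (integralMean φ) 0‖ := by
  have h := hsub.norm_deriv_zero_le hφ.1
  rw [← two_mul_deriv_zero_of_add_mul_deriv hu fun _ _ ↦ rfl,
    ← two_mul_deriv_integralMean_zero hφ.1, norm_mul, norm_mul] at h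
  exact le_of_mul_le_mul_left h (by simp)

theorem add_mul_deriv_quotient_eq (hφ : IsConvexFunction φ) (hu : DifferentiableOn ℂ u unitDisk)
    {q : ℂ → ℂ}
    (hq : ∀ y, y ≠ 0 → q y = (integralMean φ y - u y) / (y * deriv (integralMean φ) y))
    (hz : z ∈ unitDisk) (hz0 : z ≠ 0) :
    q z + deriv (integralMean φ) z / deriv φ z * (z * deriv q z) =
      (φ z - (u z + z * deriv u z)) / (z * deriv φ z) := by
  set ψ := integralMean φ
  have hψφ : ∀ y ∈ unitDisk, ψ y + y * deriv ψ y = φ y := fun y hy ↦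
    integralMean_add_mul_deriv hφ.1 hy
  have hψ : HasDerivAt ψ (deriv ψ z) z :=
    (differentiableAt_of_mem_unitDisk (differentiableOn_integralMean hφ.1) hz).hasDerivAt
  have hA : HasDerivAt (fun y ↦ y * (ψ y - u y)) (φ z - (u z + z * deriv u z)) z := by
    refine ((hasDerivAt_id' z).fun_mul
      (hψ.fun_sub (differentiableAt_of_mem_unitDisk hu hz).hasDerivAt)).congr_deriv ?_
    rw [← hψφ z hz]
    ring
  have hB : HasDerivAt (fun y ↦ y * (φ y - ψ y)) (z * deriv φ z) z := by
    refine ((hasDerivAt_id' z).fun_mul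
      ((differentiableAt_of_mem_unitDisk hφ.1 hz).hasDerivAt.fun_sub hψ)).congr_deriv ?_
    rw [← hψφ z hz]
    ring
  have hB_eq : ∀ y ∈ unitDisk, y * (φ y - ψ y) = y * (y * deriv ψ y) := fun y hy ↦ by
    rw [← hψφ y hy, add_sub_cancel_left]
  have hquot : q =ᶠ[𝓝 z] fun y ↦ y * (ψ y - u y) / (y * (φ y - ψ y)) := by
    filter_upwards [isOpen_unitDisk.mem_nhds hz, isOpen_ne.mem_nhds hz0] with y hy hy0
    rw [hB_eq y hy, mul_div_mul_left _ _ hy0, hq y hy0]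
  have hψ' : deriv ψ z ≠ 0 := hφ.deriv_integralMean_ne_zero hz
  have hφ' : deriv φ z ≠ 0 := hφ.deriv_ne_zero hz
  rw [deriv_div_deriv_eq hA hB (by simp [hB_eq z hz, hz0, hψ']) (mul_ne_zero hz0 hφ'),
    ← hquot.deriv_eq, hB_eq z hz, mul_div_mul_left _ _ hz0, mul_div_mul_left _ _ hz0, hq z hz0]
  ring

theorem re_integralMean_sub_div_nonneg (hφ : IsConvexFunction φ)
    (hu : DifferentiableOn ℂ u unitDisk) (hsub : Subordinate (fun z ↦ u z + z * deriv u z) φ)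
    (hz : z ∈ unitDisk) :
    0 ≤ ((integralMean φ z - u z) / (z * deriv (integralMean φ) z)).re := by
  rcases eq_or_ne z 0 with rfl | hz0
  · simp
  set ψ := integralMean φ
  have hψ : DifferentiableOn ℂ ψ unitDisk := differentiableOn_integralMean hφ.1
  have hψ' : ∀ y ∈ unitDisk, deriv ψ y ≠ 0 := fun y ↦ hφ.deriv_integralMean_ne_zero
  have hsub₀ : ψ 0 - u 0 = 0 := by
    simpa [ψ, integralMean_zero, sub_eq_zero] using hsub.apply_zero.symm
  set q : ℂ → ℂ := fun y ↦ dslope (ψ - u) 0 y / deriv ψ y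
  have hq_eq : ∀ y, y ≠ 0 → q y = (ψ y - u y) / (y * deriv ψ y) := fun y hy ↦ by
    simp only [q, dslope_of_ne _ hy, slope_def_field, Pi.sub_apply, hsub₀, sub_zero, div_div]
  have hq : DifferentiableOn ℂ q unitDisk :=
    ((differentiableOn_dslope (isOpen_unitDisk.mem_nhds zero_mem_unitDisk)).2 (hψ.sub hu)).div
      (hψ.deriv isOpen_unitDisk) hψ'
  have hq₀ : q 0 = 1 - deriv u 0 / deriv ψ 0 := by
    simp only [q, dslope_same]
    rw [deriv_sub (differentiableAt_of_mem_unitDisk hψ zero_mem_unitDisk)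
      (differentiableAt_of_mem_unitDisk hu zero_mem_unitDisk), sub_div,
      div_self (hψ' 0 zero_mem_unitDisk)]
  have hq₀_re : 0 ≤ (q 0).re := by
    have hle : ‖deriv u 0 / deriv ψ 0‖ ≤ 1 := by
      rw [norm_div]
      exact div_le_one_of_le₀ (hφ.norm_deriv_zero_le_integralMean hu hsub) (norm_nonneg _)
    rw [hq₀, sub_re, one_re, sub_nonneg]
    exact (re_le_norm _).trans hle
  rw [← hq_eq z hz0]
  refine re_nonneg_of_re_add_mul_deriv_nonneg hq
    (fun y ↦ hφ.re_deriv_integralMean_div_nonneg) (fun y hy ↦ ?_) hz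
  rcases eq_or_ne y 0 with rfl | hy0
  · simpa using hq₀_re
  obtain ⟨w, hw, hgw⟩ := hsub
  replace hgw : u y + y * deriv u y = φ (w y) := hgw y hy
  rw [hφ.add_mul_deriv_quotient_eq hu hq_eq hy hy0, hgw]
  exact hφ.re_sub_div_nonneg hy (hw.norm_le hy)

theorem re_integralMean_sub_div_nonneg_of_norm_le (hφ : IsConvexFunction φ)
    (hu : DifferentiableOn ℂ u unitDisk) (hsub : Subordinate (fun z ↦ u z + z * deriv u z) φ)
    {ζ : ℂ} (hζ : ζ ∈ unitDisk) (hz : ‖z‖ ≤ ‖ζ‖) :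
    0 ≤ ((integralMean φ ζ - u z) / (ζ * deriv (integralMean φ) ζ)).re := by
  rcases eq_or_ne ζ 0 with rfl | hζ0
  · simp
  set x := z / ζ
  have hx : ‖x‖ ≤ 1 := by simpa [x] using div_le_one_of_le₀ hz (norm_nonneg ζ)
  have hsub_x : Subordinate (fun y ↦ u (x * y) + y * deriv (fun y ↦ u (x * y)) y) φ :=
    (hsub.comp_const_mul hx).congr fun y hy ↦ by
      simp only [(hasDerivAt_comp_const_mul hu hx hy).deriv]
      ring
  simpa only [x, div_mul_cancel₀ z hζ0] using
    hφ.re_integralMean_sub_div_nonneg (differentiableOn_comp_const_mul hu hx) hsub_x hζ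

end IsConvexFunction

theorem isConvexFunction_integralMean {φ : ℂ → ℂ} (hφ : IsConvexFunction φ) :
    IsConvexFunction (integralMean φ) := by
  have hψ : DifferentiableOn ℂ (integralMean φ) unitDisk := differentiableOn_integralMean hφ.1
  have hsub : Subordinate (fun z ↦ integralMean φ z + z * deriv (integralMean φ) z) φ :=
    (Subordinate.refl φ).congr fun _ hz ↦ integralMean_add_mul_deriv hφ.1 hz
  refine ⟨hψ, hφ.injOn_integralMean, ?_⟩
  rintro _ ⟨z₁, hz₁, rfl⟩ _ ⟨z₂, hz₂, rfl⟩ a b ha hb hab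
  obtain ⟨r, hr, hr₁⟩ := exists_between
    (max_lt (mem_unitDisk.1 hz₁) (mem_unitDisk.1 hz₂))
  obtain ⟨hz₁r, hz₂r⟩ := max_lt_iff.1 hr
  have hre : ∀ ζ ξ, ‖ζ‖ = r → ‖ξ‖ ≤ r →
      0 ≤ ((integralMean φ ζ - integralMean φ ξ) / (ζ * deriv (integralMean φ) ζ)).re := by
    rintro ζ ξ rfl hξ
    exact hφ.re_integralMean_sub_div_nonneg_of_norm_le hψ hsub (mem_unitDisk.2 hr₁) hξ
  refine image_mono (closedBall_subset_ball hr₁) (mem_image_closedBall_of_re_sub_div_nonneg hψ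
    hφ.injOn_integralMean ((norm_nonneg z₁).trans_lt hz₁r) hr₁ hre fun ζ hζ ↦ ?_)
  have hsplit : integralMean φ ζ - (a • integralMean φ z₁ + b • integralMean φ z₂) =
      a • (integralMean φ ζ - integralMean φ z₁) + b • (integralMean φ ζ - integralMean φ z₂) := by
    nth_rw 1 [← Convex.combo_self hab (integralMean φ ζ)]
    module
  rw [hsplit, add_div, smul_div_assoc, smul_div_assoc, add_re, smul_re, smul_re]
  exact add_nonneg (smul_nonneg ha (hre ζ z₁ hζ hz₁r.le)) (smul_nonneg hb (hre ζ z₂ hζ hz₂r.le))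

/-- The case `γ = 1` of the Hallenbeck–Ruscheweyh theorem. -/
theorem subordinate_integralMean {φ u : ℂ → ℂ} (hφ : IsConvexFunction φ)
    (hu : DifferentiableOn ℂ u unitDisk) (hsub : Subordinate (fun z ↦ u z + z * deriv u z) φ) :
    Subordinate u (integralMean φ) := by
  have hψ : IsConvexFunction (integralMean φ) := isConvexFunction_integralMean hφ
  have hu₀ : u 0 = integralMean φ 0 := by
    simpa only [zero_mul, add_zero, integralMean_zero] using hsub.apply_zero
  refine Subordinate.of_injOn hψ.1 hψ.2.1 hu hu₀ fun z hz ↦ ?_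
  obtain ⟨r, hr, hr₁⟩ := exists_between (mem_unitDisk.1 hz)
  refine image_mono (closedBall_subset_ball hr₁) (mem_image_closedBall_of_re_sub_div_nonneg hψ.1
    hψ.2.1 ((norm_nonneg z).trans_lt hr) hr₁ ?_ ?_)
  · rintro ζ ξ rfl hξ
    exact hψ.re_sub_div_nonneg (mem_unitDisk.2 hr₁) hξ
  · rintro ζ rfl
    exact hφ.re_integralMean_sub_div_nonneg_of_norm_le hu hsub (mem_unitDisk.2 hr₁) hr.le

section SquareRoot

variable {φ : ℂ → ℂ} {a b : ℂ}

theorem cpow_half_sq (a : ℂ) : (a ^ (1 / 2 : ℂ)) ^ 2 = a := by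
  rw [one_div, cpow_ofNat_inv_pow]

theorem re_cpow_half_pos (ha : 0 < a.re) : 0 < (a ^ (1 / 2 : ℂ)).re := by
  have ha0 : a ≠ 0 := fun h ↦ ha.ne' (by rw [h, zero_re])
  have him : (log a * (1 / 2 : ℂ)).im = arg a / 2 := by
    rw [one_div, ← div_eq_mul_inv, div_ofNat_im, log_im]
  have harg : |arg a / 2| < Real.pi / 2 := by
    rw [abs_div, abs_two]
    exact (half_le_self (abs_nonneg _)).trans_lt (abs_arg_lt_pi_div_two_iff.2 (Or.inl ha))
  rw [cpow_def_of_ne_zero ha0, exp_re, him]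
  exact mul_pos (Real.exp_pos _) (Real.cos_pos_of_mem_Ioo (abs_lt.1 harg))

theorem eq_cpow_half_of_sq_eq (hb : 0 < b.re) (h : b ^ 2 = a) : b = a ^ (1 / 2 : ℂ) := by
  rw [← h, one_div, sq_cpow_two_inv hb]

theorem isCaratheodory_sqrtMean (hφ : DifferentiableOn ℂ φ unitDisk) (hφ₀ : φ 0 = 1)
    (hre : ∀ z ∈ unitDisk, 0 < (φ z).re) : IsCaratheodory (sqrtMean φ) := by
  obtain ⟨hψ, hψ₀, hψre⟩ := isCaratheodory_integralMean hφ hφ₀ hre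
  exact ⟨hψ.cpow (differentiableOn_const _) fun z hz ↦ Or.inl (hψre z hz),
    by rw [sqrtMean, hψ₀, one_cpow], fun z hz ↦ re_cpow_half_pos (hψre z hz)⟩

theorem IsConvexFunction.injOn_sqrtMean (hφ : IsConvexFunction φ) :
    InjOn (sqrtMean φ) unitDisk := fun z hz y hy hzy ↦
  hφ.injOn_integralMean hz hy <| by
    rw [← cpow_half_sq (integralMean φ z), ← cpow_half_sq (integralMean φ y)]
    exact congrArg (· ^ 2) hzy

end SquareRoot

/-- `a` is the sequence of Taylor coefficients at the origin of the function `F` on the unit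
disk. -/
def HasTaylorCoeffs (F : ℂ → ℂ) (a : ℕ → ℂ) : Prop :=
  ∀ z ∈ unitDisk, HasSum (fun n ↦ a n * z ^ n) (F z)

theorem hasTaylorCoeffs_iteratedDeriv {F : ℂ → ℂ} (hF : DifferentiableOn ℂ F unitDisk) :
    HasTaylorCoeffs F fun n ↦ (n.factorial : ℂ)⁻¹ * iteratedDeriv n F 0 := fun z hz ↦ by
  convert! hasSum_taylorSeries_on_ball hF hz using 2 with n
  simp only [sub_zero, smul_eq_mul]
  ring

namespace HasTaylorCoeffs

variable {F : ℂ → ℂ} {a b : ℕ → ℂ} {z : ℂ}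

theorem summable_norm (h : HasTaylorCoeffs F a) {ρ : ℝ} (hρ₀ : 0 ≤ ρ) (hρ₁ : ρ < 1) :
    Summable fun n ↦ ‖a n‖ * ρ ^ n := by
  have hρ : ‖(ρ : ℂ)‖ = ρ := by rw [norm_real, Real.norm_of_nonneg hρ₀]
  simpa only [norm_mul, norm_pow, hρ] using (h ρ (mem_unitDisk.2 (hρ.trans_lt hρ₁))).summable.norm

theorem hasFPowerSeriesOnBall (h : HasTaylorCoeffs F a) :
    HasFPowerSeriesOnBall F (FormalMultilinearSeries.ofScalars ℂ a) 0 1 := by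
  refine ⟨ENNReal.le_of_forall_nnreal_lt fun r hr ↦ ?_, one_pos, fun {y} hy ↦ ?_⟩
  · exact FormalMultilinearSeries.le_radius_of_summable _ <| by
      simpa using h.summable_norm r.2 (by exact_mod_cast hr)
  · rw [← ENNReal.coe_one, eball_coe] at hy
    simpa [FormalMultilinearSeries.ofScalars_apply_eq, mul_comm] using h y hy

theorem differentiableOn (h : HasTaylorCoeffs F a) : DifferentiableOn ℂ F unitDisk := by
  have hdiff := h.hasFPowerSeriesOnBall.differentiableOn
  rwa [← ENNReal.coe_one, eball_coe] at hdiff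

theorem unique (ha : HasTaylorCoeffs F a) (hb : HasTaylorCoeffs F b) : a = b :=
  FormalMultilinearSeries.ofScalars_series_injective ℂ ℂ
    (ha.hasFPowerSeriesOnBall.hasFPowerSeriesAt.eq_formalMultilinearSeries
      hb.hasFPowerSeriesOnBall.hasFPowerSeriesAt)

theorem apply_zero (h : HasTaylorCoeffs F a) : F 0 = a 0 := by
  simpa using (h 0 zero_mem_unitDisk).unique (hasSum_single 0 fun n hn ↦ by simp [hn])

protected theorem deriv (h : HasTaylorCoeffs F a) :
    HasTaylorCoeffs (deriv F) fun n ↦ (n + 1) * a (n + 1) := by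
  convert! hasTaylorCoeffs_iteratedDeriv (h.differentiableOn.deriv isOpen_unitDisk) using 2 with n
  rw [h.unique (hasTaylorCoeffs_iteratedDeriv h.differentiableOn), ← iteratedDeriv_succ']
  have hn : (n : ℂ) + 1 ≠ 0 := by exact_mod_cast n.succ_ne_zero
  simp only [Nat.factorial_succ]
  push_cast
  field

theorem deriv_zero (h : HasTaylorCoeffs F a) : _root_.deriv F 0 = a 1 := by
  simpa using h.deriv.apply_zero

theorem mul_deriv (h : HasTaylorCoeffs F a) :
    HasTaylorCoeffs (fun z ↦ z * _root_.deriv F z) fun n ↦ n * a n := fun z hz ↦ by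
  rw [← hasSum_nat_add_iff' 1]
  simp only [Finset.sum_range_one, Nat.cast_zero, zero_mul, sub_zero]
  convert! (h.deriv z hz).mul_left z using 2 with n
  push_cast
  ring

end HasTaylorCoeffs

section Parseval

variable {a : ℕ → ℂ} {F : ℂ → ℂ}

theorem sum_norm_sq_eq_circleAverage (a : ℕ → ℂ) (N : ℕ) :
    ∑ n ∈ Finset.range N, ‖a n‖ ^ 2 =
      Real.circleAverage (fun z ↦ ‖∑ n ∈ Finset.range N, a n * z ^ n‖ ^ 2) 0 1 := by
  set p : Polynomial ℂ := ∑ n ∈ Finset.range N, Polynomial.monomial n (a n)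
  have hcoeff : ∀ n, p.coeff n = if n < N then a n else 0 := fun n ↦ by
    simp [p, Polynomial.coeff_monomial]
  have heval : ∀ z, p.eval z = ∑ n ∈ Finset.range N, a n * z ^ n := fun z ↦ by
    simp only [p, Polynomial.eval_finsetSum, Polynomial.eval_monomial]
  have hsupport : p.support ⊆ Finset.range N := fun n hn ↦ by
    rw [Polynomial.mem_support_iff, hcoeff] at hn
    exact Finset.mem_range.2 (ite_ne_right_iff.1 hn).1
  have hsum : ∑ n ∈ p.support, ‖p.coeff n‖ ^ 2 = ∑ n ∈ Finset.range N, ‖a n‖ ^ 2 := by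
    rw [Finset.sum_subset hsupport fun n _ hn ↦ by simp [Polynomial.notMem_support_iff.1 hn]]
    exact Finset.sum_congr rfl fun n hn ↦ by rw [hcoeff, if_pos (Finset.mem_range.1 hn)]
  simpa only [← hsum, ← heval] using p.sum_sq_norm_coeff_eq_circleAverage

theorem hasSum_norm_sq_circleAverage (ha : Summable fun n ↦ ‖a n‖)
    (hF : ∀ z, ‖z‖ = 1 → HasSum (fun n ↦ a n * z ^ n) (F z)) :
    HasSum (fun n ↦ ‖a n‖ ^ 2) (Real.circleAverage (fun z ↦ ‖F z‖ ^ 2) 0 1) := by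
  have hcircle : ∀ θ, ‖circleMap 0 1 θ‖ = 1 := fun θ ↦ by rw [norm_circleMap_zero, abs_one]
  rw [hasSum_iff_tendsto_nat_of_nonneg fun n ↦ by positivity]
  simp_rw [sum_norm_sq_eq_circleAverage, Real.circleAverage_def]
  refine Tendsto.const_smul (intervalIntegral.tendsto_integral_filter_of_dominated_convergence
    (fun _ ↦ (∑' n, ‖a n‖) ^ 2) (Eventually.of_forall fun N ↦ ?_)
    (Eventually.of_forall fun N ↦ Eventually.of_forall fun θ _ ↦ ?_) intervalIntegrable_const
    (Eventually.of_forall fun θ _ ↦ ?_)) _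
  · have := continuous_circleMap 0 1
    exact Continuous.aestronglyMeasurable (by fun_prop)
  · rw [Real.norm_of_nonneg (by positivity)]
    refine pow_le_pow_left₀ (norm_nonneg _) ((norm_sum_le _ _).trans ?_) 2
    simpa only [norm_mul, norm_pow, hcircle, one_pow, mul_one] using
      ha.sum_le_tsum (Finset.range N) fun n _ ↦ norm_nonneg (a n)
  · exact ((hF _ (hcircle θ)).tendsto_sum_nat.norm).pow 2

end Parseval

section Rogosinski

variable {g φ : ℂ → ℂ} {c : ℕ → ℂ} {m : ℕ}

theorem sum_pow_pow_of_isPrimitiveRoot {R : Type*} [CommRing R] [IsDomain R] {ε : R}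
    (hε : IsPrimitiveRoot ε m) (n : ℕ) :
    ∑ k ∈ Finset.range m, (ε ^ k) ^ n = if m ∣ n then (m : R) else 0 := by
  simp_rw [← pow_mul, mul_comm _ n, pow_mul]
  split_ifs with hmn
  · simp [(hε.pow_eq_one_iff_dvd n).2 hmn]
  · have hne : ε ^ n - 1 ≠ 0 := sub_ne_zero.2 fun h ↦ hmn ((hε.pow_eq_one_iff_dvd n).1 h)
    refine (mul_eq_zero_iff_right hne).1 ?_
    rw [geom_sum_mul, ← pow_mul, mul_comm n m, pow_mul, hε.pow_eq_one, one_pow, sub_self]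

theorem HasTaylorCoeffs.hasSum_average_rotations (hg : HasTaylorCoeffs g c) (hm : m ≠ 0) {ε : ℂ}
    (hε : IsPrimitiveRoot ε m) {z : ℂ} (hz : z ∈ unitDisk) :
    HasSum (fun j ↦ c (m * j) * (z ^ m) ^ j)
      (∑ k ∈ Finset.range m, (m : ℂ)⁻¹ * g (ε ^ k * z)) := by
  have hsum : HasSum (fun n ↦ ∑ k ∈ Finset.range m, (m : ℂ)⁻¹ * (c n * (ε ^ k * z) ^ n))
      (∑ k ∈ Finset.range m, (m : ℂ)⁻¹ * g (ε ^ k * z)) :=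
    hasSum_sum fun k _ ↦
      (hg _ (mul_mem_unitDisk (by simp [hε.norm'_eq_one hm]) hz)).mul_left _
  have hterm : ∀ n, ∑ k ∈ Finset.range m, (m : ℂ)⁻¹ * (c n * (ε ^ k * z) ^ n) =
      (m : ℂ)⁻¹ * (c n * z ^ n) * if m ∣ n then (m : ℂ) else 0 := fun n ↦ by
    rw [← sum_pow_pow_of_isPrimitiveRoot hε, Finset.mul_sum]
    exact Finset.sum_congr rfl fun k _ ↦ by rw [mul_pow]; ring
  have hinj : Function.Injective (m * ·) := mul_right_injective₀ hm
  rw [funext hterm, ← hinj.hasSum_iff fun n hn ↦ by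
    rw [if_neg fun ⟨j, hj⟩ ↦ hn ⟨j, hj.symm⟩, mul_zero]] at hsum
  have hm' : (m : ℂ) ≠ 0 := Nat.cast_ne_zero.2 hm
  convert! hsum using 2 with j
  simp only [Function.comp_apply, dvd_mul_right, if_true, pow_mul]
  field

theorem HasTaylorCoeffs.exists_of_mapsTo_convex (hg : HasTaylorCoeffs g c) (hm : m ≠ 0)
    {S : Set ℂ} (hS : Convex ℝ S) (hgS : MapsTo g unitDisk S) :
    ∃ H : ℂ → ℂ, HasTaylorCoeffs H (fun j ↦ c (m * j)) ∧ MapsTo H unitDisk S := by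
  have hε := isPrimitiveRoot_exp m hm
  set ε := exp (2 * Real.pi * I / m)
  have hH : ∀ z ∈ unitDisk, ∃ v ∈ S, HasSum (fun j ↦ c (m * j) * z ^ j) v := fun z hz ↦ by
    obtain ⟨y, rfl⟩ := IsAlgClosed.exists_pow_nat_eq z (Nat.pos_of_ne_zero hm)
    have hy : y ∈ unitDisk := by
      rw [mem_unitDisk, norm_pow] at hz
      exact mem_unitDisk.2 ((pow_lt_one_iff_of_nonneg (norm_nonneg y) hm).1 hz)
    refine ⟨_, ?_, hg.hasSum_average_rotations hm hε hy⟩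
    have hmean : ∑ k ∈ Finset.range m, (m : ℝ)⁻¹ • g (ε ^ k * y) ∈ S :=
      hS.sum_mem (fun _ _ ↦ by positivity) (by simp [hm])
        fun k _ ↦ hgS (mul_mem_unitDisk (by simp [hε.norm'_eq_one hm]) hy)
    simpa only [real_smul, ofReal_inv, ofReal_natCast] using hmean
  choose! H hHS hHsum using hH
  exact ⟨H, hHsum, hHS⟩

/-- Rogosinski's theorem. -/
theorem Subordinate.norm_taylorCoeff_le (hgφ : Subordinate g φ) (hφ : IsConvexFunction φ)
    (hg : HasTaylorCoeffs g c) (hm : m ≠ 0) : ‖c m‖ ≤ ‖deriv φ 0‖ := by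
  obtain ⟨H, hH, hHφ⟩ := hg.exists_of_mapsTo_convex hm hφ.2.2 fun _ ↦ hgφ.mem_image
  have hH₀ : H 0 = φ 0 := by rw [hH.apply_zero, mul_zero, ← hg.apply_zero, hgφ.apply_zero]
  have hsub : Subordinate H φ := .of_injOn hφ.1 hφ.2.1 hH.differentiableOn hH₀ hHφ
  simpa only [hH.deriv_zero, mul_one] using hsub.norm_deriv_zero_le hφ.1

end Rogosinski

section HolomorphicLog

variable {g : ℂ → ℂ}

theorem exists_exp_eq_of_ne_zero (hg : DifferentiableOn ℂ g unitDisk) (hg₀ : g 0 = 1)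
    (hne : ∀ z ∈ unitDisk, g z ≠ 0) :
    ∃ L : ℂ → ℂ, DifferentiableOn ℂ L unitDisk ∧ L 0 = 0 ∧ ∀ z ∈ unitDisk, g z = exp (L z) := by
  obtain ⟨L, hL₀, hL⟩ := ((hg.deriv isOpen_unitDisk).div hg hne).isExactOn_ball.with_val_at 0 0
  refine ⟨L, fun z hz ↦ (hL z hz).differentiableAt.differentiableWithinAt, hL₀, fun z hz ↦ ?_⟩
  have hderiv : ∀ y ∈ unitDisk, HasDerivAt (fun y ↦ g y * exp (-L y)) 0 y := fun y hy ↦ by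
    refine ((differentiableAt_of_mem_unitDisk hg hy).hasDerivAt.fun_mul
      (hL y hy).fun_neg.cexp).congr_deriv ?_
    have := hne y hy
    simp only [Pi.div_apply]
    field
  have hconst := isOpen_unitDisk.is_const_of_deriv_eq_zero (convex_ball (0 : ℂ) 1).isPreconnected
    (fun y hy ↦ (hderiv y hy).differentiableAt.differentiableWithinAt)
    (fun y hy ↦ (hderiv y hy).deriv) hz zero_mem_unitDisk
  simpa [hL₀, hg₀, exp_neg, mul_inv_eq_one₀ (exp_ne_zero _)] using hconst

end HolomorphicLog

section StarQuot

variable {f L φ : ℂ → ℂ} {γ : ℕ → ℂ} {z : ℂ}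

theorem starQuot_zero (f : ℂ → ℂ) : starQuot f 0 = 1 := if_pos rfl

theorem starQuot_of_ne_zero (f : ℂ → ℂ) (hz : z ≠ 0) : starQuot f z = z * deriv f z / f z :=
  if_neg hz

theorem hasDerivAt_of_eq_mul_exp (hL : DifferentiableOn ℂ L unitDisk)
    (hfL : ∀ z ∈ unitDisk, f z = z * exp (L z)) (hz : z ∈ unitDisk) :
    HasDerivAt f (exp (L z) * (1 + z * deriv L z)) z := by
  have hexp := (hasDerivAt_id' z).fun_mul (differentiableAt_of_mem_unitDisk hL hz).hasDerivAt.cexp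
  have heq : f =ᶠ[𝓝 z] fun z ↦ z * exp (L z) := by
    filter_upwards [isOpen_unitDisk.mem_nhds hz] with y hy using hfL y hy
  exact (hexp.congr_of_eventuallyEq heq).congr_deriv (by ring)

theorem starQuot_of_eq_mul_exp (hL : DifferentiableOn ℂ L unitDisk)
    (hfL : ∀ z ∈ unitDisk, f z = z * exp (L z)) (hz : z ∈ unitDisk) :
    starQuot f z = 1 + z * deriv L z := by
  rcases eq_or_ne z 0 with rfl | hz0
  · rw [starQuot_zero, zero_mul, add_zero]
  · rw [starQuot_of_ne_zero f hz0, (hasDerivAt_of_eq_mul_exp hL hfL hz).deriv, hfL z hz]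
    have := exp_ne_zero (L z)
    field

theorem IsLogCoeffs.hasTaylorCoeffs_starQuot (hγ : IsLogCoeffs f γ) :
    HasTaylorCoeffs (starQuot f) fun n ↦ if n = 0 then 1 else 2 * n * γ n := fun z hz ↦ by
  obtain ⟨L, hfL, hL⟩ := hγ
  have hL' : HasTaylorCoeffs L fun n ↦ if n = 0 then 0 else 2 * γ n := fun y hy ↦ by
    rw [← hasSum_nat_add_iff' 1]
    simpa using hL y hy
  rw [starQuot_of_eq_mul_exp hL'.differentiableOn hfL hz]
  convert! (hasSum_ite_eq (0 : ℕ) (1 : ℂ)).add (hL'.mul_deriv z hz) using 2 with n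
  rcases eq_or_ne n 0 with rfl | hn
  · simp
  · simp only [if_neg hn]
    ring

theorem ClassA.exists_isLogCoeffs (hf : ClassA f) (hne : ∀ z ∈ unitDisk, z ≠ 0 → f z ≠ 0) :
    ∃ γ : ℕ → ℂ, IsLogCoeffs f γ := by
  obtain ⟨hdiff, hf₀, hf'₀⟩ := hf
  have hfg : ∀ z, z * dslope f 0 z = f z := fun z ↦ by simpa [hf₀] using sub_smul_dslope f 0 z
  have hg₀ : dslope f 0 0 = 1 := by rw [dslope_same, hf'₀]
  have hg_ne : ∀ z ∈ unitDisk, dslope f 0 z ≠ 0 := fun z hz h ↦ by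
    rcases eq_or_ne z 0 with rfl | hz0
    · exact one_ne_zero (hg₀.symm.trans h)
    · exact hne z hz hz0 (by rw [← hfg, h, mul_zero])
  obtain ⟨L, hL, hL₀, hgL⟩ := exists_exp_eq_of_ne_zero
    ((differentiableOn_dslope (isOpen_unitDisk.mem_nhds zero_mem_unitDisk)).2 hdiff) hg₀ hg_ne
  refine ⟨fun n ↦ (n.factorial : ℂ)⁻¹ * iteratedDeriv n L 0 / 2, L,
    fun z hz ↦ by rw [← hgL z hz, hfg], fun z hz ↦ ?_⟩
  have hsum := hasTaylorCoeffs_iteratedDeriv hL z hz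
  rw [← hasSum_nat_add_iff' 1] at hsum
  simpa [hL₀, mul_div_cancel₀] using hsum

theorem exists_classA_starQuot_eq {P : ℂ → ℂ} (hP : DifferentiableOn ℂ P unitDisk)
    (hP₀ : P 0 = 1) : ∃ f : ℂ → ℂ, ClassA f ∧ ∀ z ∈ unitDisk, starQuot f z = P z := by
  have hslope : DifferentiableOn ℂ (dslope P 0) unitDisk :=
    (differentiableOn_dslope (isOpen_unitDisk.mem_nhds zero_mem_unitDisk)).2 hP
  obtain ⟨L, hL₀, hL⟩ := hslope.isExactOn_ball.with_val_at 0 0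
  have hL_diff : DifferentiableOn ℂ L unitDisk :=
    fun z hz ↦ (hL z hz).differentiableAt.differentiableWithinAt
  set f : ℂ → ℂ := fun z ↦ z * exp (L z)
  have hf : ∀ z ∈ unitDisk, HasDerivAt f (exp (L z) * (1 + z * deriv L z)) z := fun z hz ↦
    hasDerivAt_of_eq_mul_exp hL_diff (fun _ _ ↦ rfl) hz
  refine ⟨f, ⟨fun z hz ↦ (hf z hz).differentiableAt.differentiableWithinAt, zero_mul _, ?_⟩,
    fun z hz ↦ ?_⟩
  · rw [(hf 0 zero_mem_unitDisk).deriv, hL₀, exp_zero, zero_mul, add_zero, one_mul]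
  · have hPz : z * dslope P 0 z = P z - 1 := by
      rw [← hP₀, ← sub_smul_dslope P 0 z, sub_zero, smul_eq_mul]
    rw [starQuot_of_eq_mul_exp hL_diff (fun _ _ ↦ rfl) hz, (hL z hz).deriv, hPz,
      add_sub_cancel]

theorem diffExpr_eq_sq_add_mul_deriv_sq (hP : DifferentiableOn ℂ (starQuot f) unitDisk)
    (hz : z ∈ unitDisk) :
    diffExpr f z = starQuot f z ^ 2 + z * deriv (fun y ↦ starQuot f y ^ 2) z := by
  rw [((differentiableAt_of_mem_unitDisk hP hz).hasDerivAt.fun_pow 2).deriv, diffExpr]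
  push_cast
  ring

theorem ne_zero_of_subordinate_diffExpr (hre : ∀ z ∈ unitDisk, 0 < (φ z).re)
    (hsub : Subordinate (diffExpr f) φ) (hz : z ∈ unitDisk) (hz0 : z ≠ 0) : f z ≠ 0 := by
  intro hfz
  obtain ⟨y, hy, hφy⟩ := hsub.mem_image hz
  have hzero : diffExpr f z = 0 := by
    rw [diffExpr, starQuot_of_ne_zero f hz0, hfz, div_zero, zero_mul]
  exact (hre y hy).ne' (by rw [hφy, hzero, zero_re])

theorem re_pos_of_re_sq_pos {P : ℂ → ℂ} {s : Set ℂ} (hs : IsPreconnected s)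
    (hP : ContinuousOn P s) {z₀ : ℂ} (hz₀ : z₀ ∈ s) (hPz₀ : 0 < (P z₀).re)
    (hsq : ∀ z ∈ s, 0 < (P z ^ 2).re) (hz : z ∈ s) : 0 < (P z).re := by
  by_contra! hle
  obtain ⟨y, hy, hy0 : (P y).re = 0⟩ :=
    hs.intermediate_value hz hz₀ (continuous_re.comp_continuousOn hP) ⟨hle, hPz₀.le⟩
  have hPy := hsq y hy
  rw [sq, mul_re, hy0, zero_mul, zero_sub, neg_pos] at hPy
  exact hPy.not_ge (mul_self_nonneg _)

theorem subordinate_starQuot (hφ : IsConvexFunction φ) (hre : ∀ z ∈ unitDisk, 0 < (φ z).re)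
    (hP : DifferentiableOn ℂ (starQuot f) unitDisk) (hsub : Subordinate (diffExpr f) φ) :
    Subordinate (starQuot f) (sqrtMean φ) := by
  obtain ⟨w, hw, hPw⟩ := subordinate_integralMean hφ (hP.pow 2)
    (hsub.congr fun z hz ↦ (diffExpr_eq_sq_add_mul_deriv_sq hP hz).symm)
  refine ⟨w, hw, fun z hz ↦ eq_cpow_half_of_sq_eq ?_ (hPw z hz)⟩
  refine re_pos_of_re_sq_pos (convex_ball 0 1).isPreconnected hP.continuousOn zero_mem_unitDisk
    (by simp [starQuot_zero]) (fun y hy ↦ ?_) hz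
  rw [show starQuot f y ^ 2 = integralMean φ (w y) from hPw y hy]
  exact re_integralMean_pos hφ.1.continuousOn hre (hw.2.2 y hy)

theorem subordinate_diffExpr_of_starQuot_eq (hφ : DifferentiableOn ℂ φ unitDisk)
    (hsqrt : DifferentiableOn ℂ (sqrtMean φ) unitDisk)
    (hf : ∀ z ∈ unitDisk, starQuot f z = sqrtMean φ z) : Subordinate (diffExpr f) φ := by
  refine (Subordinate.refl φ).congr fun z hz ↦ ?_
  have hsq : ∀ y ∈ unitDisk, starQuot f y ^ 2 = integralMean φ y := fun y hy ↦ by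
    rw [hf y hy, sqrtMean, cpow_half_sq]
  have heq : (fun y ↦ starQuot f y ^ 2) =ᶠ[𝓝 z] integralMean φ := by
    filter_upwards [isOpen_unitDisk.mem_nhds hz] with y hy using hsq y hy
  rw [diffExpr_eq_sq_add_mul_deriv_sq (hsqrt.congr hf) hz, hsq z hz, heq.deriv_eq,
    integralMean_add_mul_deriv hφ hz]

end StarQuot

theorem IsCaratheodory.norm_deriv_zero_le_two {q : ℂ → ℂ} (hq : IsCaratheodory q) :
    ‖deriv q 0‖ ≤ 2 := by
  obtain ⟨hdiff, hq₀, hre⟩ := hq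
  have hne : ∀ z ∈ unitDisk, q z + 1 ≠ 0 := fun z hz h ↦ by
    have := congrArg re h
    rw [add_re, one_re, zero_re] at this
    linarith [hre z hz]
  have hcayley : IsSchwarz fun z ↦ (q z - 1) / (q z + 1) := by
    refine ⟨(hdiff.sub_const 1).div (hdiff.add_const 1) hne, by simp [hq₀], fun z hz ↦ ?_⟩
    rw [mem_unitDisk, norm_div, div_lt_one (norm_pos_iff.2 (hne z hz))]
    refine lt_of_pow_lt_pow_left₀ 2 (norm_nonneg _) ?_
    rw [← normSq_eq_norm_sq, ← normSq_eq_norm_sq, normSq_apply, normSq_apply]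
    simp only [sub_re, add_re, one_re, sub_im, add_im, one_im]
    nlinarith [hre z hz]
  have hq' := (differentiableAt_of_mem_unitDisk hdiff zero_mem_unitDisk).hasDerivAt
  have hderiv : deriv (fun z ↦ (q z - 1) / (q z + 1)) 0 = deriv q 0 / 2 := by
    rw [((hq'.sub_const 1).fun_div (hq'.add_const 1) (hne 0 zero_mem_unitDisk)).deriv, hq₀]
    ring
  have hle := hcayley.norm_deriv_le_one
  rwa [hderiv, norm_div, norm_ofNat, div_le_one two_pos] at hle

section MeanSquare

theorem circleAverage_sq_le {u : ℂ → ℝ} {c : ℂ} {R : ℝ} (hu : CircleIntegrable u c R)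
    (hu2 : CircleIntegrable (fun z ↦ u z ^ 2) c R) :
    Real.circleAverage u c R ^ 2 ≤ Real.circleAverage (fun z ↦ u z ^ 2) c R := by
  set A := Real.circleAverage u c R
  have hlin : CircleIntegrable (fun z ↦ (2 * A) • u z) c R := hu.const_smul
  have hdiff : CircleIntegrable (fun z ↦ u z ^ 2 - (2 * A) • u z) c R := hu2.sub hlin
  have hvariance : 0 ≤ Real.circleAverage (fun z ↦ u z ^ 2 - (2 * A) • u z + A ^ 2) c R :=
    Real.circleAverage_nonneg_of_nonneg fun z _ ↦ by
      rw [smul_eq_mul]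
      nlinarith [sq_nonneg (u z - A)]
  rw [Real.circleAverage_fun_add hdiff (circleIntegrable_const _ _ _),
    Real.circleAverage_fun_sub hu2 hlin, Real.circleAverage_fun_smul, Real.circleAverage_const,
    smul_eq_mul] at hvariance
  linarith

variable {F : ℂ → ℂ} {a d : ℕ → ℂ}

theorem HasTaylorCoeffs.hasSum_norm_sq (hF : HasTaylorCoeffs F a) {ρ : ℝ} (hρ₀ : 0 ≤ ρ)
    (hρ₁ : ρ < 1) :
    HasSum (fun n ↦ ‖a n‖ ^ 2 * (ρ ^ n) ^ 2)
      (Real.circleAverage (fun z ↦ ‖F (ρ * z)‖ ^ 2) 0 1) := by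
  have hnorm : ∀ n, ‖a n * (ρ : ℂ) ^ n‖ = ‖a n‖ * ρ ^ n := fun n ↦ by
    rw [norm_mul, norm_pow, norm_real, Real.norm_of_nonneg hρ₀]
  have hsum := hasSum_norm_sq_circleAverage (a := fun n ↦ a n * (ρ : ℂ) ^ n)
    (F := fun z ↦ F (ρ * z)) (by simpa only [hnorm] using hF.summable_norm hρ₀ hρ₁)
    fun z hz ↦ by
      have hmem : (ρ : ℂ) * z ∈ unitDisk := by
        rwa [mem_unitDisk, norm_mul, hz, mul_one, norm_real, Real.norm_of_nonneg hρ₀]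
      simpa only [mul_pow, mul_assoc] using hF _ hmem
  simpa only [hnorm, mul_pow] using hsum

theorem HasTaylorCoeffs.sq_sum_norm_sq_le (hF : HasTaylorCoeffs F a)
    (hF2 : HasTaylorCoeffs (fun z ↦ F z ^ 2) d) (hd : Summable fun n ↦ ‖d n‖ ^ 2) (N : ℕ) :
    (∑ n ∈ Finset.range N, ‖a n‖ ^ 2) ^ 2 ≤ ∑' n, ‖d n‖ ^ 2 := by
  have hinner : ∀ ρ ∈ Ioo (0 : ℝ) 1,
      (∑ n ∈ Finset.range N, ‖a n‖ ^ 2 * (ρ ^ n) ^ 2) ^ 2 ≤ ∑' n, ‖d n‖ ^ 2 := fun ρ ⟨hρ₀, hρ₁⟩ ↦ by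
    have hcont : ContinuousOn (fun z ↦ ‖F (ρ * z)‖ ^ 2) (sphere 0 |1|) := by
      refine ((hF.differentiableOn.continuousOn.comp (by fun_prop) fun z hz ↦ ?_).norm).pow 2
      rw [abs_one, mem_sphere_zero_iff_norm] at hz
      rwa [mem_unitDisk, norm_mul, hz, mul_one, norm_real, Real.norm_of_nonneg hρ₀.le]
    calc (∑ n ∈ Finset.range N, ‖a n‖ ^ 2 * (ρ ^ n) ^ 2) ^ 2
        ≤ Real.circleAverage (fun z ↦ ‖F (ρ * z)‖ ^ 2) 0 1 ^ 2 := by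
          gcongr
          exact sum_le_hasSum _ (fun n _ ↦ by positivity) (hF.hasSum_norm_sq hρ₀.le hρ₁)
      _ ≤ Real.circleAverage (fun z ↦ (‖F (ρ * z)‖ ^ 2) ^ 2) 0 1 :=
          circleAverage_sq_le hcont.circleIntegrable' (hcont.pow 2).circleIntegrable'
      _ = Real.circleAverage (fun z ↦ ‖F (ρ * z) ^ 2‖ ^ 2) 0 1 := by simp only [norm_pow]
      _ ≤ ∑' n, ‖d n‖ ^ 2 :=
          hasSum_le (fun n ↦ mul_le_of_le_one_right (by positivity)
            (pow_le_one₀ (by positivity) (pow_le_one₀ hρ₀.le hρ₁.le)))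
            (hF2.hasSum_norm_sq hρ₀.le hρ₁) hd.hasSum
  have hlim : Tendsto (fun ρ : ℝ ↦ (∑ n ∈ Finset.range N, ‖a n‖ ^ 2 * (ρ ^ n) ^ 2) ^ 2)
      (𝓝[<] 1) (𝓝 ((∑ n ∈ Finset.range N, ‖a n‖ ^ 2 * (1 ^ n) ^ 2) ^ 2)) :=
    (Continuous.tendsto (by fun_prop) 1).mono_left nhdsWithin_le_nhds
  simp only [one_pow, mul_one] at hlim
  refine le_of_tendsto hlim ?_
  filter_upwards [Ioo_mem_nhdsLT one_pos] with ρ hρ using hinner ρ hρ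

theorem hasSum_one_div_nat_add_two_sq :
    HasSum (fun n : ℕ ↦ 1 / ((n : ℝ) + 2) ^ 2) (Real.pi ^ 2 / 6 - 1) := by
  simpa [Finset.sum_range_succ] using (hasSum_nat_add_iff' 2).2 hasSum_zeta_two

theorem HasTaylorCoeffs.sq_one_add_sum_norm_sq_le (hF : HasTaylorCoeffs F a) (hF₀ : F 0 = 1)
    (hF2 : HasTaylorCoeffs (fun z ↦ F z ^ 2) d) {b : ℝ}
    (hd : ∀ n, ‖d (n + 1)‖ ≤ b / (n + 2)) (N : ℕ) :
    (1 + ∑ n ∈ Finset.range N, ‖a (n + 1)‖ ^ 2) ^ 2 ≤ 1 + (Real.pi ^ 2 / 6 - 1) * b ^ 2 := by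
  have ha₀ : a 0 = 1 := hF.apply_zero.symm.trans hF₀
  have hd₀ : d 0 = 1 := by rw [← hF2.apply_zero, hF₀, one_pow]
  have hmajorant := hasSum_one_div_nat_add_two_sq.mul_right (b ^ 2)
  have hle : ∀ n, ‖d (n + 1)‖ ^ 2 ≤ 1 / ((n : ℝ) + 2) ^ 2 * b ^ 2 := fun n ↦ by
    rw [one_div_mul_eq_div, ← div_pow]
    exact pow_le_pow_left₀ (norm_nonneg _) (hd n) 2
  have htail : Summable fun n ↦ ‖d (n + 1)‖ ^ 2 :=
    .of_nonneg_of_le (fun n ↦ by positivity) hle hmajorant.summable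
  have hsum : Summable fun n ↦ ‖d n‖ ^ 2 := (summable_nat_add_iff 1).1 htail
  have hsq := hF.sq_sum_norm_sq_le hF2 hsum (N + 1)
  rw [Finset.sum_range_succ', hsum.tsum_eq_zero_add, ha₀, hd₀, norm_one, one_pow,
    add_comm _ (1 : ℝ)] at hsq
  linarith [hasSum_le hle htail.hasSum hmajorant]

end MeanSquare

section Radius

variable {b r S T : ℝ}

theorem mul_le_one_of_sq_one_add_le {κ : ℝ} (hS : (1 + S) ^ 2 ≤ 1 + κ)
    (hT : κ * T ^ 2 ≤ 1 + 2 * T) (hT₀ : 0 ≤ T) : S * T ≤ 1 := by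
  have hsq : ((1 + S) * T) ^ 2 ≤ (1 + T) ^ 2 := by
    rw [mul_pow]
    nlinarith [mul_le_mul_of_nonneg_right hS (sq_nonneg T)]
  linarith [(abs_le.1 (sq_le_sq.1 hsq)).2, abs_of_nonneg (add_nonneg zero_le_one hT₀),
    le_abs_self ((1 + S) * T), sq_le_sq.1 hsq]

theorem sum_pow_div_sq_le {y : ℝ} (hry : r ^ 2 ≤ y) (hy : y ≤ 1) (N : ℕ) :
    ∑ n ∈ Finset.range N, (r ^ (n + 1) / (n + 1)) ^ 2 ≤ y + (Real.pi ^ 2 / 6 - 1) * y ^ 2 := by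
  have hy₀ : 0 ≤ y := (sq_nonneg r).trans hry
  have hterm : ∀ n : ℕ, (r ^ (n + 1 + 1) / ((n + 1 : ℕ) + 1)) ^ 2 ≤ 1 / ((n : ℝ) + 2) ^ 2 * y ^ 2 :=
    fun n ↦ by
      have hpow : (r ^ (n + 1 + 1)) ^ 2 ≤ y ^ 2 := by
        rw [← pow_mul, mul_comm, pow_mul]
        exact (pow_le_pow_left₀ (sq_nonneg r) hry _).trans
          (pow_le_pow_of_le_one hy₀ hy (by omega))
      have hcast : ((n + 1 : ℕ) : ℝ) + 1 = n + 2 := by push_cast; ring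
      rw [div_pow, one_div_mul_eq_div, hcast]
      gcongr
  calc ∑ n ∈ Finset.range N, (r ^ (n + 1) / ((n : ℝ) + 1)) ^ 2
      ≤ ∑ n ∈ Finset.range (N + 1), (r ^ (n + 1) / ((n : ℝ) + 1)) ^ 2 :=
        Finset.sum_le_sum_of_subset_of_nonneg (Finset.range_mono N.le_succ)
          fun n _ _ ↦ sq_nonneg _
    _ = r ^ 2 + ∑ n ∈ Finset.range N, (r ^ (n + 1 + 1) / ((n + 1 : ℕ) + 1)) ^ 2 := by
        rw [Finset.sum_range_succ', add_comm]
        simp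
    _ ≤ y + ∑ n ∈ Finset.range N, 1 / ((n : ℝ) + 2) ^ 2 * y ^ 2 := by
        gcongr with n _
        exact hterm n
    _ ≤ y + (Real.pi ^ 2 / 6 - 1) * y ^ 2 := by
        gcongr
        exact sum_le_hasSum _ (fun n _ ↦ by positivity)
          (hasSum_one_div_nat_add_two_sq.mul_right (y ^ 2))

theorem pi_sq_div_six_sub_one_lt : Real.pi ^ 2 / 6 - 1 < 0.64495 := by
  nlinarith [Real.pi_lt_d6, Real.pi_pos]

theorem le_exp_neg_four_div (hb : 3 / 2 ≤ b) (hb₂ : b ≤ 2) :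
    0.1353 * (1 - 4 / 3 * (2 - b)) ≤ Real.exp (-(4 / b)) := by
  have hexp_two : 0.1353 ≤ Real.exp (-2) := by
    rw [show (-2 : ℝ) = (2 : ℕ) * -1 by norm_num, Real.exp_nat_mul]
    exact le_trans (by norm_num) (pow_le_pow_left₀ (by norm_num) Real.exp_neg_one_gt_d9.le 2)
  have hexponent : -(4 / 3 * (2 - b)) ≤ 2 - 4 / b := by
    have : 2 - 4 / b - -(4 / 3 * (2 - b)) = 2 * (2 - b) * (2 * b - 3) / (3 * b) := by
      field_simp [show b ≠ 0 by linarith]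
      ring
    rw [← sub_nonneg, this]
    have : 0 ≤ (2 - b) * (2 * b - 3) := mul_nonneg (by linarith) (by linarith)
    exact div_nonneg (by linarith) (by linarith)
  calc 0.1353 * (1 - 4 / 3 * (2 - b)) ≤ Real.exp (-2) * Real.exp (2 - 4 / b) :=
        mul_le_mul hexp_two (by linarith [Real.add_one_le_exp (2 - 4 / b)]) (by linarith)
          (Real.exp_pos _).le
    _ = Real.exp (-(4 / b)) := by rw [← Real.exp_add]; ring_nf

theorem sum_pow_div_sq_le_of_three_halves_le (hb : 3 / 2 ≤ b) (hb₂ : b ≤ 2) (hr₀ : 0 ≤ r)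
    (hr : r ≤ 1 - Real.exp (-(4 / b))) (N : ℕ) :
    ∑ n ∈ Finset.range N, (r ^ (n + 1) / (n + 1)) ^ 2 ≤ 1.109 + 0.69 * (2 - b) := by
  have hr' : r ≤ 0.8647 + 0.1804 * (2 - b) := by linarith [le_exp_neg_four_div hb hb₂]
  have hry : r ^ 2 ≤ 0.7478 + 0.3284 * (2 - b) := by
    nlinarith [pow_le_pow_left₀ hr₀ hr' 2, mul_nonneg (sub_nonneg.2 hb₂) (sub_nonneg.2 hb)]
  refine (sum_pow_div_sq_le hry (by linarith) N).trans ?_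
  nlinarith [pi_sq_div_six_sub_one_lt, mul_nonneg (sub_nonneg.2 hb₂) (sub_nonneg.2 hb),
    sq_nonneg (0.7478 + 0.3284 * (2 - b))]

theorem mul_sum_pow_div_sq_le_one (hS₀ : 0 ≤ S)
    (hS : (1 + S) ^ 2 ≤ 1 + (Real.pi ^ 2 / 6 - 1) * b ^ 2) (hb : 0 ≤ b) (hb₂ : b ≤ 2)
    (hr₀ : 0 ≤ r) (hr : r ≤ 1 - Real.exp (-(4 / b))) (N : ℕ) :
    S * ∑ n ∈ Finset.range N, (r ^ (n + 1) / (n + 1)) ^ 2 ≤ 1 := by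
  have hκ := pi_sq_div_six_sub_one_lt
  rcases le_total b (3 / 2) with hb' | hb'
  · have hr₁ : r ^ 2 ≤ 1 := pow_le_one₀ hr₀ (by linarith [Real.exp_pos (-(4 / b))])
    refine (mul_le_mul_of_nonneg_left (sum_pow_div_sq_le hr₁ le_rfl N) hS₀).trans ?_
    refine (mul_le_mul_of_nonneg_left (show _ ≤ (1.64495 : ℝ) by linarith) hS₀).trans ?_
    refine mul_le_one_of_sq_one_add_le hS ?_ (by norm_num)
    nlinarith [mul_le_mul hκ.le (pow_le_pow_left₀ hb hb' 2) (sq_nonneg b) (by norm_num)]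
  · refine (mul_le_mul_of_nonneg_left
      (sum_pow_div_sq_le_of_three_halves_le hb' hb₂ hr₀ hr N) hS₀).trans ?_
    refine mul_le_one_of_sq_one_add_le hS ?_ (by linarith)
    have hbT : b * (1.109 + 0.69 * (2 - b)) ≤ 2.218 + 0.271 * (2 - b) := by
      nlinarith [sq_nonneg (2 - b)]
    have hbT₀ : 0 ≤ b * (1.109 + 0.69 * (2 - b)) := mul_nonneg hb (by linarith)
    rw [mul_assoc, ← mul_pow]
    nlinarith [mul_le_mul hκ.le (pow_le_pow_left₀ hbT₀ hbT 2) (by positivity) (by norm_num)]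

theorem sum_mul_pow_div_le_one {a : ℕ → ℝ} {N : ℕ}
    (ha : (1 + ∑ n ∈ Finset.range N, a n ^ 2) ^ 2 ≤ 1 + (Real.pi ^ 2 / 6 - 1) * b ^ 2)
    (hb : 0 ≤ b) (hb₂ : b ≤ 2) (hr₀ : 0 ≤ r) (hr : r ≤ 1 - Real.exp (-(4 / b))) :
    ∑ n ∈ Finset.range N, a n * (r ^ (n + 1) / (n + 1)) ≤ 1 := by
  refine le_of_abs_le ((sq_le_one_iff_abs_le_one _).1 ?_)
  calc (∑ n ∈ Finset.range N, a n * (r ^ (n + 1) / (n + 1))) ^ 2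
      ≤ (∑ n ∈ Finset.range N, a n ^ 2) * ∑ n ∈ Finset.range N, (r ^ (n + 1) / (n + 1)) ^ 2 :=
        Finset.sum_mul_sq_le_sq_mul_sq ..
    _ ≤ 1 :=
        mul_sum_pow_div_sq_le_one (Finset.sum_nonneg fun n _ ↦ sq_nonneg _) ha hb hb₂ hr₀ hr N

end Radius

section Bohr

variable {φ f : ℂ → ℂ} {γ : ℕ → ℂ} {b r : ℝ}

theorem Subordinate.norm_taylorCoeff_succ_le_div {G : ℂ → ℂ} {d : ℕ → ℂ}
    (hsub : Subordinate (fun z ↦ G z + z * deriv G z) φ) (hφ : IsConvexFunction φ)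
    (hG : HasTaylorCoeffs G d) (n : ℕ) : ‖d (n + 1)‖ ≤ ‖deriv φ 0‖ / (n + 2) := by
  have hcoeffs : HasTaylorCoeffs (fun z ↦ G z + z * deriv G z) fun n ↦ d n + n * d n :=
    fun z hz ↦ by simpa only [add_mul] using (hG z hz).add (hG.mul_deriv z hz)
  have hfactor : d (n + 1) + (n + 1 : ℕ) * d (n + 1) = (n + 2 : ℕ) * d (n + 1) := by
    push_cast
    ring
  have hle := hsub.norm_taylorCoeff_le hφ hcoeffs n.succ_ne_zero
  rw [hfactor, norm_mul, norm_natCast, mul_comm] at hle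
  rw [le_div_iff₀ (by positivity)]
  exact_mod_cast hle

theorem IsLogCoeffs.sum_norm_mul_pow_le (hγ : IsLogCoeffs f γ) (hφ : IsConvexFunction φ)
    (hφ' : IsCaratheodory φ) (hsub : Subordinate (diffExpr f) φ) (hr₀ : 0 ≤ r)
    (hr : r ≤ 1 - Real.exp (-(4 / ‖deriv φ 0‖))) (N : ℕ) :
    ∑ n ∈ Finset.range N, ‖γ (n + 1)‖ * r ^ (n + 1) ≤ 1 / 2 := by
  have hP := hγ.hasTaylorCoeffs_starQuot
  have hsq := hasTaylorCoeffs_iteratedDeriv (hP.differentiableOn.fun_pow 2)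
  have hsub' : Subordinate
      (fun z ↦ starQuot f z ^ 2 + z * deriv (fun y ↦ starQuot f y ^ 2) z) φ :=
    hsub.congr fun z hz ↦ (diffExpr_eq_sq_add_mul_deriv_sq hP.differentiableOn hz).symm
  have hbohr := sum_mul_pow_div_le_one (hP.sq_one_add_sum_norm_sq_le (starQuot_zero f) hsq
    (hsub'.norm_taylorCoeff_succ_le_div hφ hsq) N) (norm_nonneg _) hφ'.norm_deriv_zero_le_two
    hr₀ hr
  have hterm : ∀ n : ℕ, ‖if n + 1 = 0 then 1 else 2 * ((n + 1 : ℕ) : ℂ) * γ (n + 1)‖ *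
      (r ^ (n + 1) / (n + 1)) = 2 * (‖γ (n + 1)‖ * r ^ (n + 1)) := fun n ↦ by
    rw [if_neg n.succ_ne_zero, norm_mul, norm_mul, norm_natCast, norm_ofNat]
    push_cast
    field
  simp only [hterm, ← Finset.mul_sum] at hbohr
  linarith

theorem IsLogCoeffs.two_mul_tsum_norm_mul_pow_le_one (hγ : IsLogCoeffs f γ)
    (hφ : IsConvexFunction φ) (hφ' : IsCaratheodory φ) (hsub : Subordinate (diffExpr f) φ)
    (hr₀ : 0 ≤ r) (hr : r ≤ 1 - Real.exp (-(4 / ‖deriv φ 0‖))) :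
    Summable (fun m ↦ ‖γ (m + 1)‖ * r ^ (m + 1)) ∧
      2 * ∑' m, ‖γ (m + 1)‖ * r ^ (m + 1) ≤ 1 := by
  have hnonneg : ∀ m, 0 ≤ ‖γ (m + 1)‖ * r ^ (m + 1) := fun m ↦ by positivity
  have hpartial := hγ.sum_norm_mul_pow_le hφ hφ' hsub hr₀ hr
  exact ⟨summable_of_sum_range_le hnonneg hpartial,
    by linarith [Real.tsum_le_of_sum_range_le hnonneg hpartial]⟩

theorem hasSum_mul_pow_of_eq_div {c : ℕ → ℝ} (hc : ∀ m : ℕ, 1 ≤ m → c m = b / (8 * m))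
    (hr : |r| < 1) : HasSum (fun m ↦ c (m + 1) * r ^ (m + 1)) (b / 8 * -Real.log (1 - r)) := by
  convert! (Real.hasSum_pow_div_log_of_abs_lt_one hr).mul_left (b / 8) using 2 with m
  rw [hc (m + 1) (by omega)]
  push_cast
  field

theorem four_lt_mul_neg_log_one_sub (hb : 0 < b) (hr : 1 - Real.exp (-(4 / b)) < r)
    (hr₁ : r < 1) : 4 < b * -Real.log (1 - r) := by
  have hlog : Real.log (1 - r) < -(4 / b) :=
    (Real.log_lt_iff_lt_exp (sub_pos.2 hr₁)).2 (by linarith)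
  exact (div_lt_iff₀' hb).1 (lt_neg_of_lt_neg hlog)

theorem one_lt_two_mul_tsum_of_eq_div {c : ℕ → ℝ} (hc : ∀ m : ℕ, 1 ≤ m → c m = b / (8 * m))
    (hb : 0 < b) (hr : 1 - Real.exp (-(4 / b)) < r) (hr₁ : r < 1) :
    Summable (fun m ↦ c (m + 1) * r ^ (m + 1)) ∧ 1 < 2 * ∑' m, c (m + 1) * r ^ (m + 1) := by
  have hr₀ : 0 < r := by
    have : Real.exp (-(4 / b)) < 1 := Real.exp_lt_one_iff.2 (neg_neg_of_pos (by positivity))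
    linarith
  have hsum := hasSum_mul_pow_of_eq_div hc (abs_lt.2 ⟨by linarith, hr₁⟩)
  refine ⟨hsum.summable, ?_⟩
  rw [hsum.tsum_eq]
  linarith [four_lt_mul_neg_log_one_sub hb hr hr₁]

end Bohr

theorem mainTheorem9
    (φ : ℂ → ℂ) (hφ : IsConvexFunction φ) (hre : ∀ z ∈ unitDisk, 0 < (φ z).re)
    (B : ℕ → ℂ) (hB : ∀ z ∈ unitDisk, HasSum (fun n : ℕ => B n * z ^ n) (φ z))
    (hB0 : B 0 = 1) (hB1 : B 1 ≠ 0) :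
    -- the mean is a convex Caratheodory function, its root is a univalent Caratheodory function
    (IsConvexFunction (integralMean φ) ∧ IsCaratheodory (integralMean φ)) ∧
    (InjOn (sqrtMean φ) unitDisk ∧ IsCaratheodory (sqrtMean φ)) ∧
    -- the subordination and the Bohr inequality for every function of the class
    (∀ f : ℂ → ℂ, ClassA f → Subordinate (diffExpr f) φ →
      Subordinate (starQuot f) (sqrtMean φ) ∧
      (∃ γ : ℕ → ℂ, IsLogCoeffs f γ) ∧
      ∀ γ : ℕ → ℂ, IsLogCoeffs f γ →
        ∀ r : ℝ, 0 ≤ r → r ≤ 1 - Real.exp (-(4 / ‖B 1‖)) →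
          Summable (fun m : ℕ => ‖γ (m + 1)‖ * r ^ (m + 1)) ∧
          2 * ∑' m : ℕ, ‖γ (m + 1)‖ * r ^ (m + 1) ≤ 1) ∧
    -- the candidate extremal function belongs to the class
    (∃ f₀ : ℂ → ℂ, ClassA f₀ ∧ (∀ z ∈ unitDisk, starQuot f₀ z = sqrtMean φ z) ∧
      Subordinate (diffExpr f₀) φ) ∧
    -- if it attains the coefficient bounds, the radius cannot be enlarged
    (∀ f₀ : ℂ → ℂ, ClassA f₀ → (∀ z ∈ unitDisk, starQuot f₀ z = sqrtMean φ z) →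
      ∀ γ : ℕ → ℂ, IsLogCoeffs f₀ γ →
        (∀ m : ℕ, 1 ≤ m → ‖γ m‖ = ‖B 1‖ / (8 * m)) →
        ∀ r : ℝ, 1 - Real.exp (-(4 / ‖B 1‖)) < r → r < 1 →
          Summable (fun m : ℕ => ‖γ (m + 1)‖ * r ^ (m + 1)) ∧
          1 < 2 * ∑' m : ℕ, ‖γ (m + 1)‖ * r ^ (m + 1)) := by
  have hB' : HasTaylorCoeffs φ B := hB
  have hφ₀ : φ 0 = 1 := hB'.apply_zero.trans hB0
  have hsqrt := isCaratheodory_sqrtMean hφ.1 hφ₀ hre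
  rw [← hB'.deriv_zero] at hB1 ⊢
  refine ⟨⟨isConvexFunction_integralMean hφ, isCaratheodory_integralMean hφ.1 hφ₀ hre⟩,
    ⟨hφ.injOn_sqrtMean, hsqrt⟩, fun f hf hsub ↦ ?_, ?_, ?_⟩
  · obtain ⟨γ, hγ⟩ :=
      hf.exists_isLogCoeffs fun z hz hz0 ↦ ne_zero_of_subordinate_diffExpr hre hsub hz hz0
    exact ⟨subordinate_starQuot hφ hre hγ.hasTaylorCoeffs_starQuot.differentiableOn hsub, ⟨γ, hγ⟩,
      fun γ hγ r hr₀ hr ↦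
        hγ.two_mul_tsum_norm_mul_pow_le_one hφ ⟨hφ.1, hφ₀, hre⟩ hsub hr₀ hr⟩
  · obtain ⟨f₀, hf₀, hstar⟩ := exists_classA_starQuot_eq hsqrt.1 hsqrt.2.1
    exact ⟨f₀, hf₀, hstar, subordinate_diffExpr_of_starQuot_eq hφ.1 hsqrt.1 hstar⟩
  · exact fun f₀ _ _ γ _ hγ r hr hr₁ ↦
      one_lt_two_mul_tsum_of_eq_div (c := (‖γ ·‖)) hγ (norm_pos_iff.2 hB1) hr hr₁
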